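/- Assume the Exponential Time Hypothesis (ETH): 3-SAT with $q$ variables and $m$ clauses cannot be solved in time $2^{o(q)}(q+m)^{O(1)}$. Consider the problem Minimum Maximal Independent Set (MMIS): given a finite undirected graph $I$, find an inclusion-wise maximal independent set with as few vertices as possible; let $\mathrm{OPT}(I)$ be this minimum number and $|I|$ the size of the instance. Let $r,t:\mathbb{N}\to\mathbb{N}$ be any non-decreasing (total) computable functions. Then: (1) MMIS is $(r,t)$-FPT-hard in the parameter $\mathrm{OPT}$: there is no algorithm that, on every instance $I$, outputs a maximal independent set with at most $r(\mathrm{OPT}(I))\cdot\mathrm{OPT}(I)$ vertices in time $t(\mathrm{OPT}(I))\cdot|I|^{O(1)}$. (2) Consequently, MMIS is also $(r,t)$-FPT-hard in the input parameter $k$: there is no algorithm that, on every instance $I$ and every integer $k\ge 0$, in time $t(k)\cdot|I|^{O(1)}$ either outputs a maximal independent set with at most $k\cdot r(k)$ vertices or correctly certifies that $k<\mathrm{OPT}(I)$. -/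

import Mathlib

open Filter Asymptotics

namespace FPTHardness

/-! ### The model of computation

Deterministic `while` programs over binary trees (a small pure-LISP language). A program has
finitely many variables, each holding a binary tree; an elementary assignment, and the evaluation
of a test, each cost one step. This model is polynomially equivalent to multitape Turing machines
and to random access machines with logarithmic cost. -/

/-- The data: binary trees. -/
inductive Tree : Type
  | nil : Tree
  | cons : Tree → Tree → Tree

namespace Tree

/-- Number of nodes (leaves included): the length of the tree written as a string. -/
def size : Tree → ℕ
  | nil => 1
  | cons a b => a.size + b.size + 1

/-- First component; `nil` for the empty tree. -/
def head : Tree → Tree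
  | nil => nil
  | cons a _ => a

/-- Second component; `nil` for the empty tree. -/
def tail : Tree → Tree
  | nil => nil
  | cons _ b => b

/-- Lists of trees as trees. -/
def ofList : List Tree → Tree
  | [] => nil
  | a :: l => cons a (ofList l)

/-- Booleans as trees. -/
def ofBool : Bool → Tree
  | false => nil
  | true => cons nil nil

/-- Natural numbers in unary as trees. -/
def ofNat : ℕ → Tree
  | 0 => nil
  | n + 1 => cons nil (ofNat n)

end Tree

/-- The right-hand sides of elementary assignments; variables are numbered. -/
inductive Expr : Type
  | nil : Expr
  | var : ℕ → Expr
  | cons : ℕ → ℕ → Expr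
  | head : ℕ → Expr
  | tail : ℕ → Expr

/-- A store gives the current value of every variable. -/
abbrev Store : Type := ℕ → Tree

/-- The value of an expression in a store. -/
def Expr.eval (s : Store) : Expr → Tree
  | .nil => .nil
  | .var x => s x
  | .cons x y => .cons (s x) (s y)
  | .head x => (s x).head
  | .tail x => (s x).tail

/-- Programs. A test asks whether the value of a variable differs from `nil`. -/
inductive Prog : Type
  | assign : ℕ → Expr → Prog
  | seq : Prog → Prog → Prog
  | ite : ℕ → Prog → Prog → Prog
  | loop : ℕ → Prog → Prog

/-- `Exec p s n s'`: started in the store `s`, the program `p` halts after exactly `n` steps, in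
the store `s'`. -/
inductive Exec : Prog → Store → ℕ → Store → Prop
  | assign (x : ℕ) (e : Expr) (s : Store) :
      Exec (.assign x e) s 1 (Function.update s x (e.eval s))
  | seq {p p' : Prog} {s s' s'' : Store} {n n' : ℕ} :
      Exec p s n s' → Exec p' s' n' s'' → Exec (.seq p p') s (n + n') s''
  | ite_true {x : ℕ} {p p' : Prog} {s s' : Store} {n : ℕ} :
      s x ≠ Tree.nil → Exec p s n s' → Exec (.ite x p p') s (n + 1) s'
  | ite_false {x : ℕ} {p p' : Prog} {s s' : Store} {n : ℕ} :
      s x = Tree.nil → Exec p' s n s' → Exec (.ite x p p') s (n + 1) s'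
  | loop_stop {x : ℕ} {p : Prog} {s : Store} :
      s x = Tree.nil → Exec (.loop x p) s 1 s
  | loop_step {x : ℕ} {p : Prog} {s s' s'' : Store} {n n' : ℕ} :
      s x ≠ Tree.nil → Exec p s n s' → Exec (.loop x p) s' n' s'' →
        Exec (.loop x p) s (n + n' + 1) s''

/-- The initial store: the input is in variable `0`, all other variables are `nil`. -/
def initStore (input : Tree) : Store := Function.update (fun _ => Tree.nil) 0 input

/-- On `input`, the program `p` halts after exactly `n` steps, with `output` in variable `0`. -/
def Computes (p : Prog) (input : Tree) (n : ℕ) (output : Tree) : Prop :=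
  ∃ s' : Store, Exec p (initStore input) n s' ∧ s' 0 = output

/-! ### 3-SAT and the Exponential Time Hypothesis -/

/-- A literal over `q` variables: a variable and its sign (`true` for the positive literal). -/
abbrev Literal (q : ℕ) : Type := Fin q × Bool

/-- A 3-CNF formula: `q` variables and a list of clauses of three (not necessarily distinct)
literals. -/
structure ThreeCNF : Type where
  q : ℕ
  clauses : List (Literal q × Literal q × Literal q)

namespace ThreeCNF

/-- The number of clauses. -/
def m (φ : ThreeCNF) : ℕ := φ.clauses.length

/-- Some assignment of truth values makes a literal of every clause true. -/
def Satisfiable (φ : ThreeCNF) : Prop :=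
  ∃ τ : Fin φ.q → Bool, ∀ C ∈ φ.clauses,
    τ C.1.1 = C.1.2 ∨ τ C.2.1.1 = C.2.1.2 ∨ τ C.2.2.1 = C.2.2.2

/-- Encoding of a literal. -/
def encLiteral {q : ℕ} (l : Literal q) : Tree := .cons (.ofNat l.1) (.ofBool l.2)

/-- Encoding of a 3-CNF formula. -/
def enc (φ : ThreeCNF) : Tree :=
  .cons (.ofNat φ.q) (.ofList (φ.clauses.map fun C =>
    .cons (encLiteral C.1) (.cons (encLiteral C.2.1) (encLiteral C.2.2))))

end ThreeCNF

open Classical in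
/-- The program `p` decides 3-SAT in time `2 ^ o(q) * (q + m) ^ O(1)`, where `q` is the number of
variables and `m` the number of clauses. -/
def DecidesThreeSatSubexp (p : Prog) : Prop :=
  ∃ (g : ℕ → ℝ) (a c : ℕ), g =o[atTop] (fun q : ℕ => (q : ℝ)) ∧
    ∀ φ : ThreeCNF, ∃ n : ℕ, Computes p φ.enc n (.ofBool (decide φ.Satisfiable)) ∧
      (n : ℝ) ≤ a * (2 : ℝ) ^ g φ.q * ((φ.q : ℝ) + φ.m + 1) ^ c

/-- The Exponential Time Hypothesis: 3-SAT cannot be solved in time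
`2 ^ o(q) * (q + m) ^ O(1)`. -/
def ETH : Prop := ¬ ∃ p : Prog, DecidesThreeSatSubexp p

/-! ### Minimization problems and fixed-parameter inapproximability -/

/-- A minimization problem, with encodings of its instances and solutions. -/
structure MinProblem : Type 1 where
  Inst : Type
  Sol : Inst → Type
  Feasible : (I : Inst) → Sol I → Prop
  value : (I : Inst) → Sol I → ℕ
  encInst : Inst → Tree
  encSol : (I : Inst) → Sol I → Tree

namespace MinProblem

variable (P : MinProblem)

/-- The optimum value of an instance (used only where feasible solutions exist). -/
noncomputable def opt (I : P.Inst) : ℕ :=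
  sInf {v : ℕ | ∃ S : P.Sol I, P.Feasible I S ∧ P.value I S = v}

/-- The size `|I|` of an instance. -/
def instSize (I : P.Inst) : ℕ := (P.encInst I).size

/-- `p` is an `r(OPT)`-approximation algorithm with running time `t(OPT) * |I| ^ O(1)`. -/
def IsApproxInOpt (r t : ℕ → ℕ) (p : Prog) : Prop :=
  ∃ a c : ℕ, ∀ I : P.Inst, ∃ (n : ℕ) (S : P.Sol I),
    Computes p (P.encInst I) n (P.encSol I S) ∧
    n ≤ a * t (P.opt I) * P.instSize I ^ c ∧
    P.Feasible I S ∧ P.value I S ≤ r (P.opt I) * P.opt I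

/-- `(r, t)`-FPT-hardness in the parameter `OPT`. -/
def FPTHardInOpt (r t : ℕ → ℕ) : Prop := ¬ ∃ p : Prog, P.IsApproxInOpt r t p

/-- `p` is an `(r, t)`-FPT-approximation algorithm with input parameter `k`: on `(I, k)`, in time
`t(k) * |I| ^ O(1)`, it outputs a feasible solution of value at most `k * r(k)`, or it certifies
(by the output `nil`, which it may give only if this is true) that `k < OPT`. -/
def IsApproxInParam (r t : ℕ → ℕ) (p : Prog) : Prop :=
  ∃ a c : ℕ, ∀ (I : P.Inst) (k : ℕ), ∃ (n : ℕ) (o : Tree),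
    Computes p (.cons (P.encInst I) (.ofNat k)) n o ∧
    n ≤ a * t k * P.instSize I ^ c ∧
    ((∃ S : P.Sol I, o = .cons (P.encSol I S) .nil ∧
        P.Feasible I S ∧ P.value I S ≤ k * r k) ∨
      (o = .nil ∧ k < P.opt I))

/-- `(r, t)`-FPT-hardness in the input parameter `k`. -/
def FPTHardInParam (r t : ℕ → ℕ) : Prop := ¬ ∃ p : Prog, P.IsApproxInParam r t p

end MinProblem

open Classical in
/-- Minimum Maximal Independent Set: instances are finite graphs, given by their adjacency matrix;
feasible solutions are the inclusion-wise maximal independent sets, given by their membership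
vector; the value is the number of vertices. -/
noncomputable def mmis : MinProblem where
  Inst := Σ n : ℕ, SimpleGraph (Fin n)
  Sol I := Finset (Fin I.1)
  Feasible I S := Maximal I.2.IsIndepSet (S : Set (Fin I.1))
  value _ S := S.card
  encInst I := .ofList (List.ofFn fun u : Fin I.1 =>
    .ofList (List.ofFn fun v : Fin I.1 => .ofBool (decide (I.2.Adj u v))))
  encSol I S := .ofList (List.ofFn fun v : Fin I.1 => .ofBool (decide (v ∈ S)))

/-- Every finite graph has a maximal independent set, so the optimum is attained. -/
theorem mmis_exists_feasible (I : mmis.Inst) : ∃ S : mmis.Sol I, mmis.Feasible I S := by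
  obtain ⟨S, hS⟩ := I.2.maximumIndepSet_exists
  exact ⟨S, hS.isMaximalIndepSet⟩

end FPTHardness

/-! A fast approximation algorithm would decide 3-SAT in subexponential time, by a reduction with a
large gap. Split the `q` variables of a formula into `k` groups (residue classes modulo `k`). Each
group gives a clique whose vertices are all assignments of its variables, about `2 ^ (q / k)` of
them. Moreover there are `D` copies of the clause set, each copy a clique, and an assignment vertex
is adjacent to every copy of every clause that it satisfies.

If the formula is satisfiable, the `k` restrictions of a satisfying assignment form a maximal
independent set (`opt_le_of_satisfiable`). Conversely, if a maximal independent set avoids some copy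
entirely, all clauses of that copy are dominated by its assignment vertices, at most one per group,
and together these satisfy the formula. So a maximal independent set with fewer than `D` vertices
proves satisfiability (`satisfiable_of_card_lt`). With `D = k * r k + 1`, an approximate solution
tells the two cases apart. Since the classes are `k + D` cliques, `OPT` never exceeds `k + D`, which
controls the factor `t(OPT)`.

It remains to choose `k = κ q` tending to infinity, so that `2 ^ (q / k)` is `2 ^ o(q)`, but so
slowly that `D` and `t (k + D)` stay linear in `q` and `κ` is computable in polynomial time
(`exists_slow`). As `r` and `t` are merely computable, `κ q` is found by running programs for them
under a clock of `q` units (`exists_timed`). This requires that the programs of the model compute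
every recursive function (`progComputable_of_computable`), and a calculus of polynomial time
(`PolyTime`) in which the reduction can be written down. -/

namespace FPTHardness

/-! ### Renaming and clearing variables -/

/-- Renaming the variables of an expression. -/
def Expr.rename (ρ : ℕ → ℕ) : Expr → Expr
  | .nil => .nil
  | .var x => .var (ρ x)
  | .cons x y => .cons (ρ x) (ρ y)
  | .head x => .head (ρ x)
  | .tail x => .tail (ρ x)

/-- Renaming the variables of a program. -/
def Prog.rename (ρ : ℕ → ℕ) : Prog → Prog
  | .assign x e => .assign (ρ x) (e.rename ρ)
  | .seq p p' => .seq (p.rename ρ) (p'.rename ρ)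
  | .ite x p p' => .ite (ρ x) (p.rename ρ) (p'.rename ρ)
  | .loop x p => .loop (ρ x) (p.rename ρ)

theorem Expr.eval_rename (ρ : ℕ → ℕ) (s : Store) (e : Expr) :
    (e.rename ρ).eval s = e.eval (fun x => s (ρ x)) := by
  cases e <;> rfl

/-- Outside the range of `ρ` the store is arbitrary and stays untouched, so a program can run as a
subroutine inside a larger store. -/
theorem Exec.rename {ρ : ℕ → ℕ} (hρ : Function.Injective ρ) {p : Prog} {s s' : Store} {n : ℕ}
    (h : Exec p s n s') : ∀ u : Store, (fun x => u (ρ x)) = s →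
      ∃ u' : Store, Exec (p.rename ρ) u n u' ∧ (fun x => u' (ρ x)) = s' ∧
        ∀ y, y ∉ Set.range ρ → u' y = u y := by
  induction h with
  | assign x e s =>
    rintro u rfl
    refine ⟨_, Exec.assign _ _ _, ?_, ?_⟩
    · funext y
      by_cases hy : y = x
      · subst hy; simp [Expr.eval_rename]
      · simp [Function.update_of_ne hy, Function.update_of_ne (hρ.ne hy)]
    · intro y hy
      rw [Function.update_of_ne]
      rintro rfl
      exact hy ⟨x, rfl⟩
  | seq _ _ ih1 ih2 =>
    intro u hu
    obtain ⟨u1, h1, h2, h3⟩ := ih1 u hu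
    obtain ⟨u2, h4, h5, h6⟩ := ih2 u1 h2
    exact ⟨u2, .seq h1 h4, h5, fun y hy => (h6 y hy).trans (h3 y hy)⟩
  | ite_true hx _ ih =>
    rintro u rfl
    obtain ⟨u1, h1, h2, h3⟩ := ih u rfl
    exact ⟨u1, .ite_true hx h1, h2, h3⟩
  | ite_false hx _ ih =>
    rintro u rfl
    obtain ⟨u1, h1, h2, h3⟩ := ih u rfl
    exact ⟨u1, .ite_false hx h1, h2, h3⟩
  | loop_stop hx =>
    rintro u rfl
    exact ⟨u, Exec.loop_stop hx, rfl, fun _ _ => rfl⟩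
  | loop_step hx _ _ ih1 ih2 =>
    rintro u rfl
    obtain ⟨u1, h1, h2, h3⟩ := ih1 u rfl
    obtain ⟨u2, h4, h5, h6⟩ := ih2 u1 h2
    exact ⟨u2, .loop_step hx h1 h4, h5, fun y hy => (h6 y hy).trans (h3 y hy)⟩

/-- A bound on the variables that a program assigns. -/
def Prog.bound : Prog → ℕ
  | .assign x _ => x + 1
  | .seq p p' => max p.bound p'.bound
  | .ite _ p p' => max p.bound p'.bound
  | .loop _ p => p.bound

theorem Exec.eq_of_bound_le {p : Prog} {s s' : Store} {n : ℕ} (h : Exec p s n s') :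
    ∀ y, p.bound ≤ y → s' y = s y := by
  induction h with
  | assign x e s =>
    intro y hy
    rw [Function.update_of_ne]
    simp only [Prog.bound] at hy
    omega
  | seq _ _ ih1 ih2 =>
    intro y hy
    simp only [Prog.bound, max_le_iff] at hy
    rw [ih2 y hy.2, ih1 y hy.1]
  | ite_true _ _ ih =>
    intro y hy
    simp only [Prog.bound, max_le_iff] at hy
    exact ih y hy.1
  | ite_false _ _ ih =>
    intro y hy
    simp only [Prog.bound, max_le_iff] at hy
    exact ih y hy.2
  | loop_stop _ => intro y _; rfl
  | loop_step _ _ _ ih1 ih2 =>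
    intro y hy
    rw [ih2 y hy, ih1 y hy]

/-- The program that sets the variables `1, …, b` to `nil`. -/
def Prog.clear : ℕ → Prog
  | 0 => .assign 1 .nil
  | b + 1 => .seq (Prog.clear b) (.assign (b + 1) .nil)

/-- There is no empty program, so even `clear 0` assigns variable `1`. Hence the `b + 1` steps, and
hence the last clause only preserves the value `nil`. -/
theorem Exec.clear (b : ℕ) (s : Store) :
    ∃ s', Exec (Prog.clear b) s (b + 1) s' ∧ s' 0 = s 0 ∧
      (∀ y, 1 ≤ y → y ≤ b → s' y = Tree.nil) ∧ ∀ y, 1 ≤ y → s y = Tree.nil → s' y = Tree.nil := by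
  induction b with
  | zero =>
    refine ⟨_, Exec.assign _ _ _, by simp, by intros; omega, ?_⟩
    intro y _ h
    by_cases hy : y = 1
    · subst hy; simp [Expr.eval]
    · simp [Function.update_of_ne hy, h]
  | succ b ih =>
    obtain ⟨s', h1, h2, h3, h4⟩ := ih
    refine ⟨_, Exec.seq h1 (Exec.assign _ _ _), by simp [h2], ?_, ?_⟩
    · intro y hy hy'
      by_cases h : y = b + 1
      · subst h; simp [Expr.eval]
      · simp [Function.update_of_ne h, h3 y hy (by omega)]
    · intro y hy hy'
      by_cases h : y = b + 1
      · subst h; simp [Expr.eval]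
      · simp [Function.update_of_ne h, h4 y hy hy']

/-! ### Programs that leave a clean store -/

/-- On the input `x`, the program `p` halts after exactly `n` steps with the output `y` in
variable `0` and all other variables empty. -/
def Run (p : Prog) (x : Tree) (n : ℕ) (y : Tree) : Prop := Exec p (initStore x) n (initStore y)

/-- The program followed by the removal of all values except the output. -/
def Prog.tidy (p : Prog) : Prog := .seq p (.clear p.bound)

theorem initStore_of_pos (x : Tree) {y : ℕ} (hy : 1 ≤ y) : initStore x y = Tree.nil := by
  rw [initStore, Function.update_of_ne (by omega)]

/-- `Computes` permits leftovers in other variables, which would spoil composition. Only variables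
below `p.bound` can hold any, so removing them costs a constant. -/
theorem Computes.tidy {p : Prog} {x y : Tree} {n : ℕ} (h : Computes p x n y) :
    Run p.tidy x (n + (p.bound + 1)) y := by
  obtain ⟨s, h1, h2⟩ := h
  obtain ⟨s', h3, h4, h5, h6⟩ := Exec.clear p.bound s
  have : s' = initStore y := by
    funext z
    rcases Nat.eq_zero_or_pos z with rfl | hz
    · simp [h4, h2, initStore]
    · rw [initStore_of_pos y hz]
      rcases le_total z p.bound with hb | hb
      · exact h5 z hz hb
      · exact h6 z hz (by rw [h1.eq_of_bound_le z hb, initStore_of_pos x hz])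
  rw [Run, ← this]
  exact .seq h1 h3

theorem Run.computes {p : Prog} {x y : Tree} {n : ℕ} (h : Run p x n y) : Computes p x n y :=
  ⟨_, h, by simp [initStore]⟩

/-- The store whose first variables hold the values listed. -/
def store (l : List Tree) : Store := fun i => l.getD i Tree.nil

theorem store_singleton (x : Tree) : store [x] = initStore x := by
  funext i
  rcases i with _ | i <;> simp [store, initStore]

/-- Unlisted variables are `nil`, so lengthening the list gives a fresh local variable a position.
-/
theorem store_append_nil (l : List Tree) : store (l ++ [Tree.nil]) = store l := by
  funext i
  simp only [store, List.getD_eq_getElem?_getD, List.getElem?_append]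
  split_ifs with h
  · rfl
  · rw [List.getElem?_eq_none (by omega : l.length ≤ i)]
    rcases h2 : i - l.length with _ | j <;> simp

theorem update_store (l : List Tree) {i : ℕ} (hi : i < l.length) (t : Tree) :
    Function.update (store l) i t = store (l.set i t) := by
  funext j
  by_cases h : j = i
  · subst h; simp [store, hi]
  · rw [Function.update_of_ne h]
    simp [store, List.getElem?_set_ne (Ne.symm h)]

theorem Exec.assign_store {l : List Tree} {i : ℕ} (hi : i < l.length) (e : Expr) :
    Exec (.assign i e) (store l) 1 (store (l.set i (e.eval (store l)))) := by
  rw [← update_store l hi]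
  exact .assign _ _ _

/-- The renaming that moves variable `0` to `v` and the others to `w, w + 1, …`. -/
def windowMap (v w : ℕ) : ℕ → ℕ
  | 0 => v
  | i + 1 => w + i

/-- The program `p` called with variable `v` as argument and result, and the variables from `w` on
as local variables. -/
def Prog.call (p : Prog) (v w : ℕ) : Prog := p.rename (windowMap v w)

/-- The local variables lie beyond the list, where the store is `nil`, as a `Run` expects and leaves
it. -/
theorem Run.call {p : Prog} {l : List Tree} {n v w : ℕ} {y : Tree}
    (hv : v < l.length) (hw : l.length ≤ w) (h : Run p (store l v) n y) :
    Exec (p.call v w) (store l) n (store (l.set v y)) := by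
  have hinj : Function.Injective (windowMap v w) := by
    intro i j hij
    rcases i with _ | i <;> rcases j with _ | j <;> simp only [windowMap] at hij <;> omega
  obtain ⟨u, h1, h2, h3⟩ := Exec.rename hinj h (store l) (by
    funext i
    rcases i with _ | i
    · simp [windowMap, initStore]
    · rw [initStore_of_pos _ (by omega)]
      simp [windowMap, store, List.getElem?_eq_none (by omega : l.length ≤ w + i)])
  suffices hu : store (l.set v y) = u by rw [hu]; exact h1
  rw [← update_store l hv]
  funext j
  by_cases hj : j ∈ Set.range (windowMap v w)
  · obtain ⟨i, rfl⟩ := hj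
    rw [show u (windowMap v w i) = initStore y i from congrFun h2 i]
    rcases i with _ | i
    · simp [windowMap, initStore]
    · rw [initStore_of_pos _ (by omega), Function.update_of_ne (by simp only [windowMap]; omega)]
      simp [windowMap, store, List.getElem?_eq_none (by omega : l.length ≤ w + i)]
  · rw [h3 j hj, Function.update_of_ne]
    rintro rfl
    exact hj ⟨0, rfl⟩

/-! ### Combinators -/

theorem Run.seq {p q : Prog} {x y z : Tree} {n m : ℕ} (h : Run p x n y) (h' : Run q y m z) :
    Run (.seq p q) x (n + m) z := Exec.seq h h'

theorem Run.assign (e : Expr) (x : Tree) :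
    Run (.assign 0 e) x 1 (e.eval (initStore x)) := by
  rw [Run, ← store_singleton, ← store_singleton]
  exact Exec.assign_store (by simp) e

theorem store_pair_nil (x : Tree) : store [x, Tree.nil] = initStore x := by
  rw [← store_singleton, ← store_append_nil [x]]; rfl

/-- The pair of two results. -/
def Prog.pair (p q : Prog) : Prog :=
  .seq (.assign 1 (.var 0)) (.seq (p.call 0 2) (.seq (q.call 1 2)
    (.seq (.assign 0 (.cons 0 1)) (.assign 1 .nil))))

theorem Run.pair {p q : Prog} {x y z : Tree} {n m : ℕ} (h : Run p x n y) (h' : Run q x m z) :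
    Run (.pair p q) x (n + m + 3) (.cons y z) := by
  rw [Run, ← store_pair_nil, ← store_pair_nil, show n + m + 3 = 1 + (n + (m + (1 + 1))) by ring]
  refine .seq (s' := store [x, x]) (Exec.assign_store (by simp) _) (.seq (s' := store [y, x])
    (Run.call (l := [x, x]) (by simp) (by simp) h) (.seq (s' := store [y, z])
    (Run.call (l := [y, x]) (by simp) (by simp) h') (.seq (s' := store [.cons y z, z])
    (Exec.assign_store (by simp) _) (Exec.assign_store (by simp) _))))

/-- Case distinction on the first component; the branches get the second component. -/
def Prog.cases (p q : Prog) : Prog :=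
  .seq (.assign 1 (.head 0)) (.seq (.assign 0 (.tail 0))
    (.ite 1 (.seq (.assign 1 .nil) p) (.seq (.assign 1 .nil) q)))

theorem Run.cases_cons {p q : Prog} {b x y : Tree} {n : ℕ} (hb : b ≠ .nil) (h : Run p x n y) :
    Run (.cases p q) (.cons b x) (n + 4) y := by
  rw [Run, ← store_pair_nil, show n + 4 = 1 + (1 + ((1 + n) + 1)) by ring]
  refine .seq (s' := store [.cons b x, b]) (Exec.assign_store (by simp) _)
    (.seq (s' := store [x, b]) (Exec.assign_store (by simp) _)
    (.ite_true (by simpa [store] using hb)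
    (.seq (s' := store [x, .nil]) (Exec.assign_store (by simp) _) ?_)))
  rw [store_pair_nil]
  exact h

theorem Run.cases_nil {p q : Prog} {x y : Tree} {n : ℕ} (h : Run q x n y) :
    Run (.cases p q) (.cons .nil x) (n + 4) y := by
  rw [Run, ← store_pair_nil, show n + 4 = 1 + (1 + ((1 + n) + 1)) by ring]
  refine .seq (s' := store [.cons .nil x, .nil]) (Exec.assign_store (by simp) _)
    (.seq (s' := store [x, .nil]) (Exec.assign_store (by simp) _)
    (.ite_false (by simp [store])
    (.seq (s' := store [x, .nil]) (Exec.assign_store (by simp) _) ?_)))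
  rw [store_pair_nil]
  exact h

/-- Iteration as long as the first component is not empty. -/
def Prog.while (p : Prog) : Prog :=
  .seq (.assign 1 (.head 0)) (.loop 1 (.seq (p.call 0 2) (.assign 1 (.head 0))))

theorem Run.while {p : Prog} (s : ℕ → Tree) (T N : ℕ) (hN : (s N).head = .nil)
    (hs : ∀ j < N, (s j).head ≠ .nil) (h : ∀ j < N, ∃ n ≤ T, Run p (s j) n (s (j + 1))) :
    ∃ n ≤ N * (T + 2) + 2, Run p.while (s 0) n (s N) := by
  -- Induction on the number `d` of iterations still to come. Each costs at most `T` steps for the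
  -- body, one to refresh the flag and one for the test.
  have key : ∀ d j, j + d = N → ∃ n ≤ d * (T + 2) + 1,
      Exec (.loop 1 (.seq (p.call 0 2) (.assign 1 (.head 0)))) (store [s j, (s j).head]) n
        (store [s N, .nil]) := by
    intro d
    induction d with
    | zero =>
      rintro j rfl
      refine ⟨1, by omega, ?_⟩
      simp only [Nat.add_zero] at hN ⊢
      rw [hN]
      exact Exec.loop_stop (by simp [store])
    | succ d ih =>
      intro j hj
      obtain ⟨n, hn, hr⟩ := ih (j + 1) (by omega)
      obtain ⟨m, hm, hr'⟩ := h j (by omega)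
      refine ⟨(m + 1) + n + 1, by rw [Nat.succ_mul]; omega,
        .loop_step (by simpa [store] using hs j (by omega)) (.seq
          (s' := store [s (j + 1), (s j).head])
          (Run.call (l := [s j, (s j).head]) (by simp) (by simp) hr')
          (Exec.assign_store (by simp) _)) hr⟩
  obtain ⟨n, hn, hr⟩ := key N 0 (by omega)
  refine ⟨1 + n, by omega, ?_⟩
  rw [Run, ← store_pair_nil, ← store_pair_nil]
  exact .seq (Exec.assign_store (by simp) _) hr

/-! ### Trees as lists, and their sizes -/

namespace Tree

/-- The list that a tree encodes: the inverse of `Tree.ofList`. -/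
def toList : Tree → List Tree
  | nil => []
  | cons a b => a :: b.toList

@[simp] theorem toList_ofList (l : List Tree) : (ofList l).toList = l := by
  induction l with
  | nil => rfl
  | cons a l ih => simp [ofList, toList, ih]

@[simp] theorem head_cons (a b : Tree) : (cons a b).head = a := rfl
@[simp] theorem tail_cons (a b : Tree) : (cons a b).tail = b := rfl
@[simp] theorem head_nil : nil.head = nil := rfl
@[simp] theorem tail_nil : nil.tail = nil := rfl

/-- The length of the list that a tree encodes. -/
def length (t : Tree) : ℕ := t.toList.length

theorem size_head_le (t : Tree) : t.head.size ≤ t.size := by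
  cases t <;> simp [size, head]; omega

theorem size_tail_le (t : Tree) : t.tail.size ≤ t.size := by
  cases t <;> simp [size, tail]; omega

theorem length_lt_size (t : Tree) : t.length < t.size := by
  induction t with
  | nil => simp [length, toList, size]
  | cons a b _ ih => simp only [length, toList, size, List.length_cons] at *; omega

theorem size_le_of_mem {t a : Tree} (h : a ∈ t.toList) : a.size ≤ t.size := by
  induction t with
  | nil => simp [toList] at h
  | cons x b _ ih =>
    simp only [toList, List.mem_cons] at h
    simp only [size]
    rcases h with rfl | h
    · omega
    · have := ih h; omega

theorem size_ofList_le {l : List Tree} {B : ℕ} (h : ∀ a ∈ l, a.size ≤ B) :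
    (ofList l).size ≤ l.length * (B + 1) + 1 := by
  induction l with
  | nil => simp [ofList, size]
  | cons a l ih =>
    have h1 := ih fun b hb => h b (List.mem_cons_of_mem _ hb)
    have h2 := h a List.mem_cons_self
    simp only [ofList, size, List.length_cons, Nat.succ_mul]
    omega

end Tree

/-- The left fold over a list, in a context. -/
def Prog.fold (b : Prog) : Prog :=
  .seq (.while
    (.pair (.seq (.assign 0 (.head 0)) (.assign 0 (.tail 0)))
      (.pair (.seq (.assign 0 (.tail 0)) (.assign 0 (.head 0)))
        (.seq (.pair (.seq (.assign 0 (.tail 0)) (.assign 0 (.head 0)))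
          (.pair (.seq (.assign 0 (.head 0)) (.assign 0 (.head 0)))
            (.seq (.assign 0 (.tail 0)) (.assign 0 (.tail 0))))) b))))
    (.seq (.assign 0 (.tail 0)) (.assign 0 (.tail 0)))

/-- The loop state is the rest of the list, paired with the context and the accumulator, so the loop
test is emptiness of the rest. The constants pay for projections and pairings. -/
theorem Run.fold {b : Prog} (C : Tree) (l : List Tree) (s : ℕ → Tree) (T : ℕ)
    (h : ∀ (j : ℕ) (hj : j < l.length),
      ∃ n ≤ T, Run b (.cons C (.cons l[j] (s j))) n (s (j + 1))) :
    ∃ n ≤ l.length * (T + 25) + 4,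
      Run b.fold (.cons (.ofList l) (.cons C (s 0))) n (s l.length) := by
  obtain ⟨n, hn, hr⟩ := Run.while
    (p := (.pair (.seq (.assign 0 (.head 0)) (.assign 0 (.tail 0)))
      (.pair (.seq (.assign 0 (.tail 0)) (.assign 0 (.head 0)))
        (.seq (.pair (.seq (.assign 0 (.tail 0)) (.assign 0 (.head 0)))
          (.pair (.seq (.assign 0 (.head 0)) (.assign 0 (.head 0)))
            (.seq (.assign 0 (.tail 0)) (.assign 0 (.tail 0))))) b))))
    (fun j => .cons (.ofList (l.drop j)) (.cons C (s j))) (T + 23) l.length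
    (by simp [Tree.ofList])
    (fun j hj => by rw [List.drop_eq_getElem_cons hj]; simp [Tree.ofList]) (by
      intro j hj
      obtain ⟨m, hm, hr⟩ := h j hj
      rw [List.drop_eq_getElem_cons hj]
      refine ⟨_, ?_, Run.pair (.seq (.assign _ _) (.assign _ _)) (Run.pair
        (.seq (.assign _ _) (.assign _ _)) (.seq (.pair (.seq (.assign _ _) (.assign _ _))
          (.pair (.seq (.assign _ _) (.assign _ _)) (.seq (.assign _ _) (.assign _ _)))) hr))⟩
      omega)
  refine ⟨_, ?_, hr.seq (.seq (.assign _ _) (.assign _ _))⟩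
  rw [show T + 25 = T + 23 + 2 from rfl]
  omega


/-! ### Polynomial bounds -/

/-- `f` is bounded by a polynomial in `μ`. -/
def PolyBdd {ι : Type*} (μ f : ι → ℕ) : Prop := ∃ c : ℕ, ∀ i, f i ≤ (μ i + 2) ^ c

namespace PolyBdd

variable {ι : Type*} {μ f g : ι → ℕ}

theorem mono (h : PolyBdd μ g) (hf : ∀ i, f i ≤ g i) : PolyBdd μ f := by
  obtain ⟨c, hc⟩ := h
  exact ⟨c, fun i => (hf i).trans (hc i)⟩

theorem self : PolyBdd μ μ := ⟨1, fun i => by simp⟩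

/-- The base `μ i + 2` is at least `2`, so a power of it absorbs any constant. -/
theorem const (a : ℕ) : PolyBdd μ (fun _ => a) :=
  ⟨a, fun i => (Nat.lt_two_pow_self).le.trans (Nat.pow_le_pow_left (by omega) a)⟩

theorem add (hf : PolyBdd μ f) (hg : PolyBdd μ g) : PolyBdd μ (fun i => f i + g i) := by
  obtain ⟨a, ha⟩ := hf
  obtain ⟨b, hb⟩ := hg
  refine ⟨max a b + 1, fun i => ?_⟩
  have h1 := (ha i).trans (Nat.pow_le_pow_right (by omega : 0 < μ i + 2) (le_max_left a b))
  have h2 := (hb i).trans (Nat.pow_le_pow_right (by omega : 0 < μ i + 2) (le_max_right a b))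
  rw [pow_succ]
  nlinarith [Nat.zero_le (μ i * (μ i + 2) ^ max a b)]

theorem mul (hf : PolyBdd μ f) (hg : PolyBdd μ g) : PolyBdd μ (fun i => f i * g i) := by
  obtain ⟨a, ha⟩ := hf
  obtain ⟨b, hb⟩ := hg
  exact ⟨a + b, fun i => by rw [pow_add]; exact Nat.mul_le_mul (ha i) (hb i)⟩

theorem pow (hf : PolyBdd μ f) (c : ℕ) : PolyBdd μ (fun i => f i ^ c) := by
  obtain ⟨a, ha⟩ := hf
  exact ⟨a * c, fun i => by rw [pow_mul]; exact Nat.pow_le_pow_left (ha i) c⟩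

theorem trans (hf : PolyBdd μ f) (hg : PolyBdd f g) : PolyBdd μ g := by
  obtain ⟨c, hc⟩ := hg
  exact ((hf.add (const 2)).pow c).mono hc

theorem reindex {κ : Type*} (hf : PolyBdd μ f) (e : κ → ι) :
    PolyBdd (fun j => μ (e j)) (fun j => f (e j)) := by
  obtain ⟨c, hc⟩ := hf
  exact ⟨c, fun j => hc _⟩

end PolyBdd

/-! ### Polynomial-time computation of families of trees -/

/-- Some program computes `Y i` from `X i`, for every index `i`, in time polynomial in `μ i`, and
the size of `Y i` is polynomial in `μ i`. -/
def PolyTime {ι : Type*} (μ : ι → ℕ) (X Y : ι → Tree) : Prop :=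
  ∃ (p : Prog) (T : ι → ℕ), PolyBdd μ T ∧ (∀ i, ∃ n ≤ T i, Run p (X i) n (Y i)) ∧
    PolyBdd μ (fun i => (Y i).size)

namespace PolyTime

variable {ι κ : Type*} {μ ν : ι → ℕ} {X Y Z C L S : ι → Tree}

theorem size (h : PolyTime μ X Y) : PolyBdd μ (fun i => (Y i).size) := by
  obtain ⟨p, T, h1, h2, h3⟩ := h
  exact h3

theorem mono (h : PolyTime μ X Y) (hμ : PolyBdd ν μ) : PolyTime ν X Y := by
  obtain ⟨p, T, h1, h2, h3⟩ := h
  exact ⟨p, T, hμ.trans h1, h2, hμ.trans h3⟩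

theorem reindex (h : PolyTime μ X Y) (e : κ → ι) :
    PolyTime (fun j => μ (e j)) (fun j => X (e j)) (fun j => Y (e j)) := by
  obtain ⟨p, T, h1, h2, h3⟩ := h
  exact ⟨p, fun j => T (e j), h1.reindex e, fun j => h2 _, h3.reindex e⟩

theorem trans (h : PolyTime μ X Y) (h' : PolyTime μ Y Z) : PolyTime μ X Z := by
  obtain ⟨p, T, h1, h2, h3⟩ := h
  obtain ⟨p', T', h1', h2', h3'⟩ := h'
  refine ⟨.seq p p', fun i => T i + T' i, h1.add h1', fun i => ?_, h3'⟩
  obtain ⟨n, hn, hr⟩ := h2 i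
  obtain ⟨n', hn', hr'⟩ := h2' i
  exact ⟨_, add_le_add hn hn', hr.seq hr'⟩

/-- A subroutine call: the called family has its own index set, and `e` selects the instance that is
needed. -/
theorem trans_reindex {ν : κ → ℕ} {V W : κ → Tree} (e : ι → κ)
    (h : PolyTime μ X (fun i => V (e i))) (h' : PolyTime ν V W)
    (hν : PolyBdd μ (fun i => ν (e i))) : PolyTime μ X (fun i => W (e i)) :=
  h.trans ((h'.reindex e).mono hν)

theorem id (h : PolyBdd μ (fun i => (X i).size)) : PolyTime μ X X :=
  ⟨.assign 0 (.var 0), fun _ => 1, .const 1, fun _ => ⟨1, le_rfl, Run.assign _ _⟩, h⟩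

theorem head (h : PolyTime μ X Y) : PolyTime μ X (fun i => (Y i).head) :=
  h.trans ⟨.assign 0 (.head 0), fun _ => 1, .const 1, fun _ => ⟨1, le_rfl, Run.assign _ _⟩,
    h.size.mono fun _ => Tree.size_head_le _⟩

theorem tail (h : PolyTime μ X Y) : PolyTime μ X (fun i => (Y i).tail) :=
  h.trans ⟨.assign 0 (.tail 0), fun _ => 1, .const 1, fun _ => ⟨1, le_rfl, Run.assign _ _⟩,
    h.size.mono fun _ => Tree.size_tail_le _⟩

theorem cons (h : PolyTime μ X Y) (h' : PolyTime μ X Z) :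
    PolyTime μ X (fun i => .cons (Y i) (Z i)) := by
  obtain ⟨p, T, h1, h2, h3⟩ := h
  obtain ⟨p', T', h1', h2', h3'⟩ := h'
  refine ⟨.pair p p', fun i => T i + T' i + 3, (h1.add h1').add (.const 3), fun i => ?_,
    (h3.add h3').add (.const 1)⟩
  obtain ⟨n, hn, hr⟩ := h2 i
  obtain ⟨n', hn', hr'⟩ := h2' i
  exact ⟨_, by dsimp only; omega, hr.pair hr'⟩

theorem nil : PolyTime μ X (fun _ => .nil) :=
  ⟨.assign 0 .nil, fun _ => 1, .const 1, fun _ => ⟨1, le_rfl, Run.assign _ _⟩, .const 1⟩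

theorem const (t : Tree) : PolyTime μ X (fun _ => t) := by
  induction t with
  | nil => exact nil
  | cons a b iha ihb => exact iha.cons ihb

end PolyTime

/-- Case distinction on whether a tree is empty. -/
def Tree.cond : Tree → Tree → Tree → Tree
  | .nil, _, y => y
  | .cons _ _, x, _ => x

@[simp] theorem Tree.cond_nil (x y : Tree) : Tree.cond .nil x y = y := rfl
@[simp] theorem Tree.cond_cons (a b x y : Tree) : Tree.cond (.cons a b) x y = x := rfl

namespace PolyTime

variable {ι κ : Type*} {μ ν : ι → ℕ} {X Y Z C L S : ι → Tree}

theorem cond (h : PolyTime μ X C) (hY : PolyTime μ X Y) (hZ : PolyTime μ X Z) :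
    PolyTime μ X (fun i => Tree.cond (C i) (Y i) (Z i)) := by
  have hs : PolyBdd μ (fun i => (Tree.cond (C i) (Y i) (Z i)).size) :=
    (hY.size.add hZ.size).mono fun i => by
      cases C i <;> simp
  refine (h.cons (hY.cons hZ)).trans ⟨.cases (.assign 0 (.head 0)) (.assign 0 (.tail 0)),
    fun _ => 5, .const 5, fun i => ⟨5, le_rfl, ?_⟩, hs⟩
  dsimp only
  cases C i with
  | nil => exact Run.cases_nil (Run.assign _ _)
  | cons a b => exact Run.cases_cons (by simp) (Run.assign _ _)

/-- All steps are measured by `μ` at the outer index, so a single polynomial bounds every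
intermediate state. Mere polynomial time of each step in its own input would allow exponential
growth under iteration. -/
theorem fold {l : ι → List Tree} {s : ι → ℕ → Tree}
    (hstep : PolyTime (ι := {j : ι × ℕ // j.2 < (l j.1).length}) (fun j => μ j.1.1)
      (fun j => .cons (C j.1.1) (.cons ((l j.1.1)[j.1.2]'j.2) (s j.1.1 j.1.2)))
      (fun j => s j.1.1 (j.1.2 + 1)))
    (hC : PolyTime μ X C) (hl : PolyTime μ X (fun i => .ofList (l i)))
    (h0 : PolyTime μ X (fun i => s i 0)) : PolyTime μ X (fun i => s i (l i).length) := by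
  obtain ⟨b, T, ⟨c, hT⟩, hr, ⟨d, hs⟩⟩ := hstep
  have hlen : PolyBdd μ (fun i => (l i).length) := hl.size.mono fun i => by
    have := Tree.length_lt_size (.ofList (l i))
    simp only [Tree.length, Tree.toList_ofList] at this
    exact this.le
  refine (hl.cons (hC.cons h0)).trans ⟨b.fold, fun i => (l i).length * ((μ i + 2) ^ c + 25) + 4,
    (hlen.mul (((PolyBdd.self.add (.const 2)).pow c).add (.const 25))).add (.const 4),
    fun i => ?_, ?_⟩
  · refine Run.fold (C i) (l i) (s i) _ fun j hj => ?_
    obtain ⟨n, hn, h⟩ := hr ⟨(i, j), hj⟩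
    exact ⟨n, hn.trans (hT ⟨(i, j), hj⟩), h⟩
  · refine (h0.size.add ((PolyBdd.self.add (.const 2)).pow d)).mono fun i => ?_
    rcases h : (l i).length with _ | j
    · simp only [h]
      exact Nat.le_add_right _ _
    · simp only [h]
      exact (hs ⟨(i, j), by simp only; omega⟩).trans (Nat.le_add_left _ _)

end PolyTime

namespace Tree

theorem size_ofNat (n : ℕ) : (ofNat n).size = 2 * n + 1 := by
  induction n with
  | zero => rfl
  | succ n ih => simp only [ofNat, size, ih]; omega

theorem ofNat_eq_ofList (n : ℕ) : ofNat n = ofList (List.replicate n nil) := by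
  induction n with
  | zero => rfl
  | succ n ih => simp [ofNat, ofList, List.replicate_succ, ih]

theorem size_ofBool_le (b : Bool) : (ofBool b).size ≤ 3 := by
  cases b <;> simp [ofBool, size]

theorem cond_ofBool (b : Bool) (x y : Tree) : cond (ofBool b) x y = if b then x else y := by
  cases b <;> rfl

theorem size_ofList (l : List Tree) : (ofList l).size = (l.map fun a => a.size + 1).sum + 1 := by
  induction l with
  | nil => rfl
  | cons a l ih => simp only [ofList, size, ih, List.map_cons, List.sum_cons]; omega

theorem size_ofList_le_of_sublist {l l' : List Tree} (h : List.Sublist l l') :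
    (ofList l).size ≤ (ofList l').size := by
  rw [size_ofList, size_ofList]
  have := (h.map fun a : Tree => a.size + 1).sum_le_sum (fun _ _ => Nat.zero_le _)
  omega

theorem length_le_size_ofList (l : List Tree) : l.length ≤ (ofList l).size := by
  have := length_lt_size (ofList l)
  simp only [length, toList_ofList] at this
  exact this.le

theorem size_le_size_ofList {l : List Tree} {a : Tree} (h : a ∈ l) :
    a.size ≤ (ofList l).size :=
  size_le_of_mem (by simpa using h)

end Tree

/-! ### Loops over numbers and lists in polynomial time -/

section

variable {ι κ : Type*} {μ : ι → ℕ} {X Y Z W : ι → Tree} {α : Type*} {enc : α → Tree}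

theorem PolyBdd.size_cons {A B : ι → Tree} (hA : PolyBdd μ fun i => (A i).size)
    (hB : PolyBdd μ fun i => (B i).size) : PolyBdd μ fun i => (Tree.cons (A i) (B i)).size :=
  (hA.add hB).add (.const 1)

theorem PolyBdd.size_mem {l : ι → List α} (h : PolyBdd μ fun i => (Tree.ofList ((l i).map enc)).size)
    (e : κ → ι) (a : κ → α) (ha : ∀ j, a j ∈ l (e j)) :
    PolyBdd (fun j => μ (e j)) fun j => (enc (a j)).size :=
  (h.reindex e).mono fun j => Tree.size_le_size_ofList (List.mem_map_of_mem (ha j))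

/-- A family computed from `X` is computed from `X` with an additional argument. -/
theorem PolyTime.lift {V : κ → Tree} {e : κ → ι} (hX : PolyBdd μ fun i => (X i).size)
    (hV : PolyBdd (fun j => μ (e j)) fun j => (V j).size) (h : PolyTime μ X Y) :
    PolyTime (fun j => μ (e j)) (fun j => .cons (X (e j)) (V j)) (fun j => Y (e j)) :=
  PolyTime.trans_reindex e (PolyTime.head (Y := fun j => .cons (X (e j)) (V j))
    (.id ((hX.reindex e).size_cons hV))) h .self

/-- The additional argument. -/
theorem PolyTime.arg {V : κ → Tree} {e : κ → ι} (hX : PolyBdd μ fun i => (X i).size)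
    (hV : PolyBdd (fun j => μ (e j)) fun j => (V j).size) :
    PolyTime (fun j => μ (e j)) (fun j => .cons (X (e j)) (V j)) V :=
  PolyTime.tail (Y := fun j => .cons (X (e j)) (V j)) (.id ((hX.reindex e).size_cons hV))

/-- Iteration over a unary number. -/
theorem PolyTime.fold_nat {n : ι → ℕ} {st : ι → ℕ → Tree} (hX : PolyBdd μ fun i => (X i).size)
    (hn : PolyTime μ X fun i => .ofNat (n i)) (h0 : PolyTime μ X fun i => st i 0)
    (hs : PolyBdd (ι := {j : ι × ℕ // j.2 < n j.1}) (fun j => μ j.1.1)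
      fun j => (st j.1.1 j.1.2).size)
    (hstep : PolyTime (ι := {j : ι × ℕ // j.2 < n j.1}) (fun j => μ j.1.1)
      (fun j => .cons (X j.1.1) (st j.1.1 j.1.2)) fun j => st j.1.1 (j.1.2 + 1)) :
    PolyTime μ X fun i => st i (n i) := by
  have := PolyTime.fold (μ := μ) (X := X) (C := X) (l := fun i => List.replicate (n i) Tree.nil)
    (s := st) ?_ (.id hX) (by simpa only [Tree.ofNat_eq_ofList] using hn) h0
  · simpa using this
  · have hstep' := hstep.reindex
      (fun j : {j : ι × ℕ // j.2 < (List.replicate (n j.1) Tree.nil).length} =>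
        (⟨j.1, by simpa using j.2⟩ : {j : ι × ℕ // j.2 < n j.1}))
    have hs' := hs.reindex
      (fun j : {j : ι × ℕ // j.2 < (List.replicate (n j.1) Tree.nil).length} =>
        (⟨j.1, by simpa using j.2⟩ : {j : ι × ℕ // j.2 < n j.1}))
    refine PolyTime.trans ?_ hstep'
    have h := PolyTime.id (μ := fun j : {j : ι × ℕ // j.2 < (List.replicate (n j.1) Tree.nil).length}
      => μ j.1.1) (X := fun j => .cons (X j.1.1) (.cons
        ((List.replicate (n j.1.1) Tree.nil)[j.1.2]'j.2) (st j.1.1 j.1.2)))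
      ((hX.reindex _).size_cons (.size_cons
        ((PolyBdd.const 1).mono fun j => by simp [Tree.size]) hs'))
    exact h.head.cons h.tail.tail

/-- Iteration over a list; `st i l` is the state reached after the items `l`. -/
theorem PolyTime.fold_list {l : ι → List α} {st : ι → List α → Tree}
    (hX : PolyBdd μ fun i => (X i).size)
    (hl : PolyTime μ X fun i => .ofList ((l i).map enc)) (h0 : PolyTime μ X fun i => st i [])
    (hstep : PolyTime (ι := {j : ι × List α × α // j.2.1 ++ [j.2.2] <+: l j.1})
      (fun j => μ j.1.1)
      (fun j => .cons (X j.1.1) (.cons (enc j.1.2.2) (st j.1.1 j.1.2.1)))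
      fun j => st j.1.1 (j.1.2.1 ++ [j.1.2.2])) :
    PolyTime μ X fun i => st i (l i) := by
  have := PolyTime.fold (μ := μ) (X := X) (C := X) (l := fun i => (l i).map enc)
    (s := fun i j => st i ((l i).take j)) ?_ (.id hX) hl (by simpa using h0)
  · simpa using this
  · have hlt (j : {j : ι × ℕ // j.2 < ((l j.1).map enc).length}) : j.1.2 < (l j.1.1).length := by
      simpa using j.2
    have h := hstep.reindex (fun j : {j : ι × ℕ // j.2 < ((l j.1).map enc).length} =>
        (⟨(j.1.1, (l j.1.1).take j.1.2, (l j.1.1)[j.1.2]'(hlt j)), by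
          dsimp only
          rw [← List.take_succ_eq_append_getElem (hlt j)]
          exact List.take_prefix _ _⟩ : {j : ι × List α × α // j.2.1 ++ [j.2.2] <+: l j.1}))
    refine cast ?_ h
    congr 1
    · funext j
      simp
    · funext j
      dsimp only
      rw [List.take_succ_eq_append_getElem (hlt j)]

theorem mem_of_prefix {l' l : List α} {a : α} (h : l' ++ [a] <+: l) : a ∈ l :=
  h.subset (by simp)

/-- A fold that builds a list by `cons` yields it backwards; the constructions below restore the
order with this. -/
theorem PolyTime.reverse {l : ι → List Tree} (hX : PolyBdd μ fun i => (X i).size)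
    (hl : PolyTime μ X fun i => .ofList (l i)) :
    PolyTime μ X fun i => .ofList (l i).reverse := by
  have hs : PolyBdd (ι := {j : ι × List Tree × Tree // j.2.1 ++ [j.2.2] <+: l j.1})
      (fun j => μ j.1.1) fun j => (Tree.ofList j.1.2.1.reverse).size := by
    refine (hl.size.reindex _).mono fun j => ?_
    simp only [Tree.size_ofList, List.map_reverse, List.sum_reverse]
    rw [← Tree.size_ofList, ← Tree.size_ofList]
    exact Tree.size_ofList_le_of_sublist ((List.prefix_append _ _).trans j.2).sublist
  have ha := PolyBdd.size_mem (enc := fun t => t) (by simpa using hl.size)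
    (fun j : {j : ι × List Tree × Tree // j.2.1 ++ [j.2.2] <+: l j.1} => j.1.1)
    (fun j => j.1.2.2) (fun j => mem_of_prefix j.2)
  refine PolyTime.fold_list (enc := fun t => t) (st := fun _ l => .ofList l.reverse) hX
    (by simpa using hl) .nil ?_
  have h := PolyTime.arg hX (ha.size_cons hs)
  simpa [Tree.ofList] using h.head.cons h.tail

theorem PolyTime.append {l l' : ι → List Tree} (hX : PolyBdd μ fun i => (X i).size)
    (hl : PolyTime μ X fun i => .ofList (l i)) (hl' : PolyTime μ X fun i => .ofList (l' i)) :
    PolyTime μ X fun i => .ofList (l i ++ l' i) := by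
  have hs : PolyBdd (ι := {j : ι × List Tree × Tree // j.2.1 ++ [j.2.2] <+: (l j.1).reverse})
      (fun j => μ j.1.1) fun j => (Tree.ofList (j.1.2.1.reverse ++ l' j.1.1)).size := by
    refine (((hl.reverse hX).size.add hl'.size).reindex _).mono fun j => ?_
    have := Tree.size_ofList_le_of_sublist ((List.prefix_append _ _).trans j.2).sublist
    simp only [Tree.size_ofList, List.map_reverse, List.sum_reverse, List.map_append,
      List.sum_append] at this ⊢
    omega
  have ha := PolyBdd.size_mem (enc := fun t => t) (by simpa using (hl.reverse hX).size)
    (fun j : {j : ι × List Tree × Tree // j.2.1 ++ [j.2.2] <+: (l j.1).reverse} => j.1.1)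
    (fun j => j.1.2.2) (fun j => mem_of_prefix j.2)
  have := PolyTime.fold_list (enc := fun t => t) (l := fun i => (l i).reverse)
    (st := fun i m => .ofList (m.reverse ++ l' i)) hX
    (by simpa using hl.reverse hX) (by simpa using hl') (by
      have h := PolyTime.arg hX (ha.size_cons hs)
      simpa [Tree.ofList] using h.head.cons h.tail)
  simpa using this

theorem PolyBdd.size_map {l : ι → List α} {G : ι → α → Tree}
    (hl : PolyBdd μ fun i => (Tree.ofList ((l i).map enc)).size)
    (hG : PolyBdd (ι := {j : ι × α // j.2 ∈ l j.1}) (fun j => μ j.1.1)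
      fun j => (G j.1.1 j.1.2).size) :
    PolyBdd μ fun i => (Tree.ofList ((l i).map (G i))).size := by
  obtain ⟨c, hc⟩ := hG
  refine ((hl.mul (((PolyBdd.self.add (.const 2)).pow c).add (.const 1))).add (.const 1)).mono
    fun i => ?_
  refine (Tree.size_ofList_le (B := (μ i + 2) ^ c) ?_).trans ?_
  · intro a ha
    obtain ⟨x, hx, rfl⟩ := List.mem_map.1 ha
    exact hc ⟨(i, x), hx⟩
  · have := Tree.length_le_size_ofList ((l i).map enc)
    simp only [List.length_map] at this ⊢
    gcongr

theorem PolyTime.map {l : ι → List α} {G : ι → α → Tree} (hX : PolyBdd μ fun i => (X i).size)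
    (hl : PolyTime μ X fun i => .ofList ((l i).map enc))
    (hG : PolyTime (ι := {j : ι × α // j.2 ∈ l j.1}) (fun j => μ j.1.1)
      (fun j => .cons (X j.1.1) (enc j.1.2)) fun j => G j.1.1 j.1.2) :
    PolyTime μ X fun i => .ofList ((l i).map (G i)) := by
  have hs : PolyBdd (ι := {j : ι × List α × α // j.2.1 ++ [j.2.2] <+: l j.1})
      (fun j => μ j.1.1) fun j => (Tree.ofList (j.1.2.1.map (G j.1.1)).reverse).size := by
    refine ((PolyBdd.size_map hl.size hG.size).reindex _).mono fun j => ?_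
    simp only [Tree.size_ofList, List.map_reverse, List.sum_reverse]
    rw [← Tree.size_ofList, ← Tree.size_ofList]
    exact Tree.size_ofList_le_of_sublist
      ((((List.prefix_append _ _).trans j.2).sublist).map _)
  have ha := PolyBdd.size_mem hl.size
    (fun j : {j : ι × List α × α // j.2.1 ++ [j.2.2] <+: l j.1} => j.1.1)
    (fun j => j.1.2.2) (fun j => mem_of_prefix j.2)
  have := PolyTime.fold_list (st := fun i m => .ofList (m.map (G i)).reverse) hX hl .nil (by
      have h := PolyTime.arg hX (ha.size_cons hs)
      have h1 := PolyTime.id (((hX.reindex (fun j :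
        {j : ι × List α × α // j.2.1 ++ [j.2.2] <+: l j.1} => j.1.1)).size_cons
        (ha.size_cons hs)))
      have h2 := PolyTime.trans_reindex (fun j :
        {j : ι × List α × α // j.2.1 ++ [j.2.2] <+: l j.1} =>
          (⟨(j.1.1, j.1.2.2), mem_of_prefix j.2⟩ : {j : ι × α // j.2 ∈ l j.1}))
        (h1.head.cons h1.tail.head) hG .self
      simpa [Tree.ofList] using h2.cons h.tail)
  simpa using this.reverse hX

end


/-! ### A library of polynomial-time operations -/

namespace PolyTime

variable {ι κ : Type*} {μ : ι → ℕ} {X Y Z W : ι → Tree} {α β : Type*} {enc : α → Tree}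

theorem ite {b : ι → Bool} (h : PolyTime μ X fun i => .ofBool (b i)) (hY : PolyTime μ X Y)
    (hZ : PolyTime μ X Z) : PolyTime μ X fun i => if b i then Y i else Z i := by
  simpa only [Tree.cond_ofBool] using h.cond hY hZ

theorem not {a : ι → Bool} (h : PolyTime μ X fun i => .ofBool (a i)) :
    PolyTime μ X fun i => .ofBool (!a i) := by
  refine cast ?_ (h.ite (.const (.ofBool false)) (.const (.ofBool true)))
  congr 1; funext i; cases a i <;> rfl

theorem and {a b : ι → Bool} (h : PolyTime μ X fun i => .ofBool (a i))
    (h' : PolyTime μ X fun i => .ofBool (b i)) : PolyTime μ X fun i => .ofBool (a i && b i) := by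
  refine cast ?_ (h.ite h' (.const (.ofBool false)))
  congr 1; funext i; cases a i <;> rfl

theorem or {a b : ι → Bool} (h : PolyTime μ X fun i => .ofBool (a i))
    (h' : PolyTime μ X fun i => .ofBool (b i)) : PolyTime μ X fun i => .ofBool (a i || b i) := by
  refine cast ?_ (h.ite (.const (.ofBool true)) h')
  congr 1; funext i; cases a i <;> rfl

theorem bool_beq {a b : ι → Bool} (h : PolyTime μ X fun i => .ofBool (a i))
    (h' : PolyTime μ X fun i => .ofBool (b i)) : PolyTime μ X fun i => .ofBool (a i == b i) := by
  refine cast ?_ (h.ite h' h'.not)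
  congr 1; funext i; cases a i <;> cases b i <;> rfl

theorem add {a b : ι → ℕ} (hX : PolyBdd μ fun i => (X i).size)
    (ha : PolyTime μ X fun i => .ofNat (a i)) (hb : PolyTime μ X fun i => .ofNat (b i)) :
    PolyTime μ X fun i => .ofNat (a i + b i) := by
  simp only [Tree.ofNat_eq_ofList] at *
  simpa [List.replicate_append_replicate] using append hX ha hb

theorem succ {a : ι → ℕ} (ha : PolyTime μ X fun i => .ofNat (a i)) :
    PolyTime μ X fun i => .ofNat (a i + 1) := nil.cons ha

theorem sub {a b : ι → ℕ} (hX : PolyBdd μ fun i => (X i).size)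
    (ha : PolyTime μ X fun i => .ofNat (a i)) (hb : PolyTime μ X fun i => .ofNat (b i)) :
    PolyTime μ X fun i => .ofNat (a i - b i) := by
  have hs : PolyBdd (ι := {j : ι × ℕ // j.2 < b j.1}) (fun j => μ j.1.1)
      fun j => (Tree.ofNat (a j.1.1 - j.1.2)).size :=
    (ha.size.reindex _).mono fun j => by simp only [Tree.size_ofNat]; omega
  refine fold_nat (st := fun i j => .ofNat (a i - j)) hX hb (by simpa using ha) hs ?_
  refine cast ?_ (arg hX hs).tail
  congr 1; funext j
  rw [← Nat.sub_sub]
  cases a j.1.1 - j.1.2 <;> rfl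

theorem nat_eq {a b : ι → ℕ} (hX : PolyBdd μ fun i => (X i).size)
    (ha : PolyTime μ X fun i => .ofNat (a i)) (hb : PolyTime μ X fun i => .ofNat (b i)) :
    PolyTime μ X fun i => .ofBool (decide (a i = b i)) := by
  refine cast ?_ ((sub hX ha hb).cond (.const (.ofBool false))
    ((sub hX hb ha).cond (.const (.ofBool false)) (.const (.ofBool true))))
  congr 1; funext i
  rcases h : a i - b i with _ | d
  · rcases h' : b i - a i with _ | d'
    · have : a i = b i := by omega
      simp [Tree.ofNat, this]
    · have : a i ≠ b i := by omega
      simp [Tree.ofNat, this]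
  · have : a i ≠ b i := by omega
    simp [Tree.ofNat, this]

/-- The residue is counted upwards and reset to `0` whenever it reaches `k i`. -/
theorem mod {a k : ι → ℕ} (hX : PolyBdd μ fun i => (X i).size) (hk : ∀ i, 0 < k i)
    (ha : PolyTime μ X fun i => .ofNat (a i)) (hb : PolyTime μ X fun i => .ofNat (k i)) :
    PolyTime μ X fun i => .ofNat (a i % k i) := by
  have hs : PolyBdd (ι := {j : ι × ℕ // j.2 < a j.1}) (fun j => μ j.1.1)
      fun j => (Tree.ofNat (j.1.2 % k j.1.1)).size :=
    (ha.size.reindex _).mono fun j => by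
      have h1 := j.2
      have h2 := Nat.mod_le j.1.2 (k j.1.1)
      simp only [Tree.size_ofNat]; omega
  refine fold_nat (st := fun i j => .ofNat (j % k i)) hX ha (by simpa using const (.ofNat 0)) hs ?_
  have hs' := arg hX hs
  have hX' := (hX.reindex (fun j : {j : ι × ℕ // j.2 < a j.1} => j.1.1)).size_cons hs
  refine cast ?_ ((nat_eq hX' hs'.succ (hb.lift hX hs)).ite (.const (.ofNat 0)) hs'.succ)
  congr 1; funext j
  have h1 := Nat.mod_lt j.1.2 (hk j.1.1)
  have h2 := Nat.div_add_mod j.1.2 (k j.1.1)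
  have h3 : (j.1.2 + 1) % k j.1.1 = (j.1.2 % k j.1.1 + 1) % k j.1.1 := by
    rw [Nat.mod_add_mod]
  rw [h3]
  by_cases h : j.1.2 % k j.1.1 + 1 = k j.1.1
  · simp [h]
  · rw [Nat.mod_eq_of_lt (by omega : j.1.2 % k j.1.1 + 1 < k j.1.1)]
    simp [h]

theorem range {n : ι → ℕ} (hX : PolyBdd μ fun i => (X i).size)
    (hn : PolyTime μ X fun i => .ofNat (n i)) :
    PolyTime μ X fun i => .ofList ((List.range (n i)).map .ofNat) := by
  have hs : PolyBdd (ι := {j : ι × ℕ // j.2 < n j.1}) (fun j => μ j.1.1)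
      fun j => (Tree.cons (.ofNat j.1.2)
        (.ofList (((List.range j.1.2).map .ofNat).reverse))).size := by
    refine (((hn.size.mul (hn.size.add (.const 1))).add (.const 1)).add
      (hn.size.add (.const 1))).reindex (fun j : {j : ι × ℕ // j.2 < n j.1} => j.1.1) |>.mono
      fun j => ?_
    have h1 := j.2
    have h2 : (Tree.ofList (((List.range j.1.2).map .ofNat).reverse)).size ≤
        j.1.2 * ((2 * n j.1.1 + 1) + 1) + 1 := by
      have := Tree.size_ofList_le (l := ((List.range j.1.2).map .ofNat).reverse)
        (B := 2 * n j.1.1 + 1) (by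
          intro a ha
          simp only [List.mem_reverse, List.mem_map, List.mem_range] at ha
          obtain ⟨x, hx, rfl⟩ := ha
          rw [Tree.size_ofNat]; omega)
      simpa using this
    have h3 : j.1.2 * ((2 * n j.1.1 + 1) + 1) ≤ (2 * n j.1.1 + 1) * ((2 * n j.1.1 + 1) + 1) :=
      Nat.mul_le_mul_right _ (by omega)
    simp only [Tree.size_ofNat, Tree.size]
    omega
  have := fold_nat (st := fun i j => .cons (.ofNat j)
    (.ofList (((List.range j).map .ofNat).reverse))) hX hn (.const _) hs (by
      have h := arg hX hs
      refine cast ?_ ((nil.cons h.head).cons (h.head.cons h.tail))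
      congr 1; funext j
      simp [List.range_succ, Tree.ofList, Tree.ofNat])
  simpa using this.tail.reverse hX

theorem size_flatMap {l : ι → List α} {G : ι → α → List Tree}
    (hl : PolyBdd μ fun i => (Tree.ofList ((l i).map enc)).size)
    (hG : PolyBdd (ι := {j : ι × α // j.2 ∈ l j.1}) (fun j => μ j.1.1)
      fun j => (Tree.ofList (G j.1.1 j.1.2)).size) :
    PolyBdd μ fun i => (Tree.ofList ((l i).flatMap (G i))).size := by
  refine (PolyBdd.size_map (G := fun i a => .ofList (G i a)) hl hG).mono fun i => ?_
  induction l i with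
  | nil => simp
  | cons a l ih =>
    simp only [List.flatMap_cons, List.map_cons, Tree.ofList, Tree.size, Tree.size_ofList,
      List.map_append, List.sum_append] at ih ⊢
    omega

theorem flatMap {l : ι → List α} {G : ι → α → List Tree} (hX : PolyBdd μ fun i => (X i).size)
    (hl : PolyTime μ X fun i => .ofList ((l i).map enc))
    (hG : PolyTime (ι := {j : ι × α // j.2 ∈ l j.1}) (fun j => μ j.1.1)
      (fun j => .cons (X j.1.1) (enc j.1.2)) fun j => .ofList (G j.1.1 j.1.2)) :
    PolyTime μ X fun i => .ofList ((l i).flatMap (G i)) := by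
  have hs : PolyBdd (ι := {j : ι × List α × α // j.2.1 ++ [j.2.2] <+: l j.1})
      (fun j => μ j.1.1) fun j => (Tree.ofList (j.1.2.1.flatMap (G j.1.1))).size := by
    refine ((size_flatMap hl.size hG.size).reindex _).mono fun j => ?_
    obtain ⟨m, hm⟩ := j.2
    rw [← hm]
    simp only [List.flatMap_append, Tree.size_ofList, List.map_append, List.sum_append]
    omega
  have ha := PolyBdd.size_mem hl.size
    (fun j : {j : ι × List α × α // j.2.1 ++ [j.2.2] <+: l j.1} => j.1.1)
    (fun j => j.1.2.2) (fun j => mem_of_prefix j.2)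
  refine fold_list (st := fun i m => .ofList (m.flatMap (G i))) hX hl .nil ?_
  have h := arg hX (ha.size_cons hs)
  have hX' := ((hX.reindex (fun j :
    {j : ι × List α × α // j.2.1 ++ [j.2.2] <+: l j.1} => j.1.1)).size_cons (ha.size_cons hs))
  have h1 := id hX'
  have h2 := trans_reindex (fun j :
    {j : ι × List α × α // j.2.1 ++ [j.2.2] <+: l j.1} =>
      (⟨(j.1.1, j.1.2.2), mem_of_prefix j.2⟩ : {j : ι × α // j.2 ∈ l j.1}))
    (h1.head.cons h1.tail.head) hG .self
  simpa using append hX' h.tail h2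

theorem any {l : ι → List α} {p : ι → α → Bool} (hX : PolyBdd μ fun i => (X i).size)
    (hl : PolyTime μ X fun i => .ofList ((l i).map enc))
    (hp : PolyTime (ι := {j : ι × α // j.2 ∈ l j.1}) (fun j => μ j.1.1)
      (fun j => .cons (X j.1.1) (enc j.1.2)) fun j => .ofBool (p j.1.1 j.1.2)) :
    PolyTime μ X fun i => .ofBool ((l i).any (p i)) := by
  have hs : PolyBdd (ι := {j : ι × List α × α // j.2.1 ++ [j.2.2] <+: l j.1})
      (fun j => μ j.1.1) fun j => (Tree.ofBool (j.1.2.1.any (p j.1.1))).size :=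
    (PolyBdd.const 3).mono fun j => Tree.size_ofBool_le _
  have ha := PolyBdd.size_mem hl.size
    (fun j : {j : ι × List α × α // j.2.1 ++ [j.2.2] <+: l j.1} => j.1.1)
    (fun j => j.1.2.2) (fun j => mem_of_prefix j.2)
  refine fold_list (st := fun i m => .ofBool (m.any (p i))) hX hl .nil ?_
  have h := arg hX (ha.size_cons hs)
  have hX' := ((hX.reindex (fun j :
    {j : ι × List α × α // j.2.1 ++ [j.2.2] <+: l j.1} => j.1.1)).size_cons (ha.size_cons hs))
  have h1 := id hX'
  have h2 := trans_reindex (fun j :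
    {j : ι × List α × α // j.2.1 ++ [j.2.2] <+: l j.1} =>
      (⟨(j.1.1, j.1.2.2), mem_of_prefix j.2⟩ : {j : ι × α // j.2 ∈ l j.1}))
    (h1.head.cons h1.tail.head) hp .self
  simpa using or h.tail h2

theorem zipIdx {l : ι → List α} (hX : PolyBdd μ fun i => (X i).size)
    (hl : PolyTime μ X fun i => .ofList ((l i).map enc)) :
    PolyTime μ X fun i => .ofList ((l i).zipIdx.map fun a => .cons (.ofNat a.2) (enc a.1)) := by
  have hs : PolyBdd (ι := {j : ι × List α × α // j.2.1 ++ [j.2.2] <+: l j.1})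
      (fun j => μ j.1.1) fun j => (Tree.cons (.ofNat j.1.2.1.length)
        (.ofList (j.1.2.1.zipIdx.map fun a => .cons (.ofNat a.2) (enc a.1)).reverse)).size := by
    refine (((((PolyBdd.const 2).mul hl.size).add (.const 1)).add
      ((hl.size.mul ((((PolyBdd.const 2).mul hl.size).add hl.size).add (.const 3))).add
        (.const 1))).add (.const 1)).reindex
      (fun j : {j : ι × List α × α // j.2.1 ++ [j.2.2] <+: l j.1} => j.1.1) |>.mono fun j => ?_
    have h0 : j.1.2.1 <+: l j.1.1 := (List.prefix_append _ _).trans j.2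
    have h1 := h0.length_le
    have h2 := Tree.length_le_size_ofList ((l j.1.1).map enc)
    rw [List.length_map] at h2
    have h3 := Tree.size_ofList_le
      (l := (j.1.2.1.zipIdx.map fun a => Tree.cons (.ofNat a.2) (enc a.1)).reverse)
      (B := 2 * (Tree.ofList ((l j.1.1).map enc)).size + (Tree.ofList ((l j.1.1).map enc)).size + 2)
      (by
        intro t ht
        simp only [List.mem_reverse, List.mem_map] at ht
        obtain ⟨⟨a, n⟩, ha, rfl⟩ := ht
        have h4 := List.snd_lt_of_mem_zipIdx ha
        have h5 := Tree.size_le_size_ofList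
          (List.mem_map_of_mem (f := enc) (h0.subset (List.fst_mem_of_mem_zipIdx ha)))
        simp only [Tree.size, Tree.size_ofNat] at h4 h5 ⊢
        omega)
    simp only [List.length_reverse, List.length_map, List.length_zipIdx] at h3
    simp only [Tree.size, Tree.size_ofNat]
    refine Nat.add_le_add (Nat.add_le_add (by omega) (h3.trans ?_)) le_rfl
    gcongr
    omega
  have ha := PolyBdd.size_mem hl.size
    (fun j : {j : ι × List α × α // j.2.1 ++ [j.2.2] <+: l j.1} => j.1.1)
    (fun j => j.1.2.2) (fun j => mem_of_prefix j.2)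
  have := fold_list (st := fun _ m => .cons (.ofNat m.length)
    (.ofList (m.zipIdx.map fun a => .cons (.ofNat a.2) (enc a.1)).reverse)) hX hl (.const _) (by
      have h := arg hX (ha.size_cons hs)
      refine cast ?_ ((nil.cons h.tail.head).cons
        ((h.tail.head.cons h.head).cons h.tail.tail))
      congr 1; funext j
      simp [List.zipIdx_append, Tree.ofList, Tree.ofNat])
  simpa using this.tail.reverse hX

end PolyTime


/-! ### Partial recursive functions are computed by programs -/

/-- Some program computes `Y i` from `X i`, for every index `i`. -/
def ProgComputable {ι : Type*} (X Y : ι → Tree) : Prop := ∃ p : Prog, ∀ i, ∃ n, Run p (X i) n (Y i)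

namespace ProgComputable

variable {ι κ : Type*} {X Y Z : ι → Tree}

theorem trans (h : ProgComputable X Y) (h' : ProgComputable Y Z) : ProgComputable X Z := by
  obtain ⟨p, hp⟩ := h
  obtain ⟨p', hp'⟩ := h'
  refine ⟨.seq p p', fun i => ?_⟩
  obtain ⟨n, hr⟩ := hp i
  obtain ⟨n', hr'⟩ := hp' i
  exact ⟨_, hr.seq hr'⟩

theorem reindex (h : ProgComputable X Y) (e : κ → ι) :
    ProgComputable (fun j => X (e j)) (fun j => Y (e j)) := by
  obtain ⟨p, hp⟩ := h
  exact ⟨p, fun j => hp (e j)⟩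

theorem self : ProgComputable X X := ⟨.assign 0 (.var 0), fun _ => ⟨1, Run.assign _ _⟩⟩

theorem head (h : ProgComputable X Y) : ProgComputable X (fun i => (Y i).head) :=
  h.trans ⟨.assign 0 (.head 0), fun _ => ⟨1, Run.assign _ _⟩⟩

theorem tail (h : ProgComputable X Y) : ProgComputable X (fun i => (Y i).tail) :=
  h.trans ⟨.assign 0 (.tail 0), fun _ => ⟨1, Run.assign _ _⟩⟩

theorem nil : ProgComputable X (fun _ => .nil) := ⟨.assign 0 .nil, fun _ => ⟨1, Run.assign _ _⟩⟩

theorem cons (h : ProgComputable X Y) (h' : ProgComputable X Z) :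
    ProgComputable X (fun i => .cons (Y i) (Z i)) := by
  obtain ⟨p, hp⟩ := h
  obtain ⟨p', hp'⟩ := h'
  refine ⟨.pair p p', fun i => ?_⟩
  obtain ⟨n, hr⟩ := hp i
  obtain ⟨n', hr'⟩ := hp' i
  exact ⟨_, hr.pair hr'⟩

theorem iterate_tail (h : ProgComputable X Y) (k : ℕ) :
    ProgComputable X (fun i => Tree.tail^[k] (Y i)) := by
  induction k with
  | zero => exact h
  | succ k ih => simpa only [Function.iterate_succ_apply'] using ih.tail

theorem ofFn {n : ℕ} {Y : Fin n → ι → Tree} (h : ∀ k, ProgComputable X (Y k)) :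
    ProgComputable X (fun i => .ofList (List.ofFn fun k => Y k i)) := by
  induction n with
  | zero => simpa [Tree.ofList] using nil
  | succ n ih =>
    simpa [Tree.ofList, List.ofFn_succ] using (h 0).cons (ih fun k => h k.succ)

theorem fold_nat {n : ι → ℕ} {st : ι → ℕ → Tree} (hn : ProgComputable X fun i => .ofNat (n i))
    (h0 : ProgComputable X fun i => st i 0)
    (hstep : ProgComputable (fun j : ι × ℕ => .cons (X j.1) (st j.1 j.2))
      fun j => st j.1 (j.2 + 1)) : ProgComputable X fun i => st i (n i) := by
  have hstep' : ProgComputable (fun j : ι × ℕ => .cons (X j.1) (.cons .nil (st j.1 j.2)))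
      fun j => st j.1 (j.2 + 1) := (self.head.cons self.tail.tail).trans hstep
  obtain ⟨b, hb⟩ := hstep'
  choose T hT using hb
  refine (hn.cons (self.cons h0)).trans ⟨b.fold, fun i => ?_⟩
  -- `Run.fold` wants one bound for all steps; as time does not matter here, the sum of the step
  -- times serves.
  obtain ⟨m, -, hm⟩ := Run.fold (X i) (List.replicate (n i) .nil) (st i)
    (∑ j ∈ Finset.range (n i), T (i, j)) (fun j hj => ⟨T (i, j), Finset.single_le_sum
      (f := fun j => T (i, j)) (fun _ _ => Nat.zero_le _) (by simpa using hj), by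
        simpa using hT (i, j)⟩)
  exact ⟨m, by simpa [Tree.ofNat_eq_ofList] using hm⟩

/-- Unbounded search for the first index at which a flag is empty. -/
theorem find {st : ι → ℕ → Tree} {N : ι → ℕ} (h0 : ProgComputable X fun i => st i 0)
    (hstep : ProgComputable (fun j : {j : ι × ℕ // j.2 < N j.1} => st j.1.1 j.1.2)
      fun j => st j.1.1 (j.1.2 + 1))
    (hN : ∀ i, (st i (N i)).head = .nil) (hlt : ∀ i, ∀ j < N i, (st i j).head ≠ .nil) :
    ProgComputable X fun i => st i (N i) := by
  obtain ⟨b, hb⟩ := hstep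
  choose T hT using hb
  refine h0.trans ⟨b.while, fun i => ?_⟩
  obtain ⟨m, -, hm⟩ := Run.while (p := b) (st i)
    (∑ j : Fin (N i), T ⟨(i, j), j.2⟩) (N i) (hN i) (hlt i)
    (fun j hj => ⟨T ⟨(i, j), hj⟩, Finset.single_le_sum
      (f := fun j : Fin (N i) => T ⟨(i, j), j.2⟩) (fun _ _ => Nat.zero_le _)
      (Finset.mem_univ ⟨j, hj⟩), hT ⟨(i, j), hj⟩⟩)
  exact ⟨m, hm⟩

end ProgComputable

/-- Vectors of natural numbers as trees. -/
def encVector {n : ℕ} (v : List.Vector ℕ n) : Tree := .ofList (v.toList.map .ofNat)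

theorem encVector_cons {n : ℕ} (a : ℕ) (v : List.Vector ℕ n) :
    encVector (a ::ᵥ v) = .cons (.ofNat a) (encVector v) := by
  simp [encVector, Tree.ofList]

theorem encVector_tail {n : ℕ} (v : List.Vector ℕ (n + 1)) :
    (encVector v).tail = encVector v.tail := by
  conv_lhs => rw [← v.cons_head_tail, encVector_cons]
  rfl

theorem encVector_head {n : ℕ} (v : List.Vector ℕ (n + 1)) :
    (encVector v).head = .ofNat v.head := by
  conv_lhs => rw [← v.cons_head_tail, encVector_cons]
  rfl

theorem encVector_eq_ofFn {n : ℕ} (v : List.Vector ℕ n) :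
    encVector v = .ofList (List.ofFn fun k => .ofNat (v.get k)) := by
  rw [encVector]
  congr 1
  conv_lhs => rw [← v.ofFn_get, List.Vector.toList_ofFn, List.map_ofFn]
  rfl

theorem iterate_tail_ofList (l : List Tree) (k : ℕ) :
    Tree.tail^[k] (.ofList l) = .ofList (l.drop k) := by
  induction k with
  | zero => simp
  | succ k ih =>
    rw [Function.iterate_succ_apply', ih, ← List.drop_drop]
    cases l.drop k <;> simp [Tree.ofList]

/-- Primitive recursion is a counted loop whose state holds the counter and the current value. -/
theorem progComputable_of_primrec' {n : ℕ} {f : List.Vector ℕ n → ℕ} (hf : Nat.Primrec' f) :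
    ProgComputable encVector fun v => .ofNat (f v) := by
  induction hf with
  | zero => exact .nil
  | succ =>
    have := ProgComputable.nil.cons (ProgComputable.self (X := encVector (n := 1))).head
    simpa [encVector_head, Tree.ofNat] using this
  | @get n i =>
    refine cast ?_ ((ProgComputable.self (X := encVector (n := n))).iterate_tail i).head
    congr 1; funext v
    rw [encVector_eq_ofFn, iterate_tail_ofList, List.drop_eq_getElem_cons (by simp)]
    simp [Tree.ofList]
  | @comp m n f g _ _ ihf ihg =>
    have := (ProgComputable.ofFn ihg).trans (Z := fun v => .ofNat (f (List.Vector.ofFn (g · v))))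
      (by simpa [encVector_eq_ofFn] using ihf.reindex fun v => List.Vector.ofFn (g · v))
    exact this
  | @prec n f g _ _ ihf ihg =>
    let R : List.Vector ℕ (n + 1) → ℕ → ℕ := fun v j =>
      Nat.rec (f v.tail) (fun y IH => g (y ::ᵥ IH ::ᵥ v.tail)) j
    have hX := ProgComputable.self (X := encVector (n := n + 1))
    have h := ProgComputable.fold_nat (X := encVector (n := n + 1)) (n := fun v => v.head)
      (st := fun v j => .cons (.ofNat j) (.ofNat (R v j)))
      (by simpa [encVector_head] using hX.head)
      (ProgComputable.nil.cons (by
        refine ProgComputable.trans (Y := fun v => encVector v.tail) ?_ (ihf.reindex _)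
        simpa [encVector_tail] using hX.tail))
      (by
        have hS := ProgComputable.self (X := fun j : List.Vector ℕ (n + 1) × ℕ =>
          .cons (encVector j.1) (.cons (.ofNat j.2) (.ofNat (R j.1 j.2))))
        refine ProgComputable.cons (ProgComputable.nil.cons hS.tail.head) ?_
        have h2 := (hS.tail.head.cons (hS.tail.tail.cons hS.head.tail)).trans
          (Z := fun j => .ofNat (g (j.2 ::ᵥ R j.1 j.2 ::ᵥ j.1.tail))) (by
            simpa [encVector_cons, encVector_tail] using
              ihg.reindex fun j : List.Vector ℕ (n + 1) × ℕ => j.2 ::ᵥ R j.1 j.2 ::ᵥ j.1.tail)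
        exact h2)
    exact h.tail

theorem get_mem_of_mem_mOfFn {n : ℕ} {g : Fin n → Part ℕ} {w : List.Vector ℕ n}
    (h : w ∈ List.Vector.mOfFn g) (i : Fin n) : w.get i ∈ g i := by
  induction n with
  | zero => exact i.elim0
  | succ n ih =>
    simp only [List.Vector.mOfFn, Part.bind_eq_bind, Part.mem_bind_iff, Part.pure_eq_some,
      Part.mem_some_iff] at h
    obtain ⟨a, ha, u, hu, rfl⟩ := h
    refine Fin.cases ?_ (fun i => ?_) i
    · simpa using ha
    · simpa using ih hu i

/-- The index set is the graph of `f`, so halting is claimed only where `f` is defined. -/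
theorem progComputable_of_partrec' {n : ℕ} {f : List.Vector ℕ n →. ℕ} (hf : Nat.Partrec' f) :
    ProgComputable (fun x : {x : List.Vector ℕ n × ℕ // x.2 ∈ f x.1} => encVector x.1.1)
      fun x => .ofNat x.1.2 := by
  induction hf with
  | @prim n f hf =>
    refine cast ?_ ((progComputable_of_primrec' hf).reindex fun x : {x : List.Vector ℕ n × ℕ //
      x.2 ∈ (f : List.Vector ℕ n →. ℕ) x.1} => x.1.1)
    congr 1; funext x
    have := x.2
    simp only [PFun.coe_val, Part.mem_some_iff] at this
    rw [this]
  | @comp m n f g _ _ ihf ihg =>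
    have key (x : {x : List.Vector ℕ m × ℕ //
        x.2 ∈ ((List.Vector.mOfFn fun i => g i x.1) >>= f)}) :
        ∃ w : List.Vector ℕ n, (∀ i, w.get i ∈ g i x.1.1) ∧ x.1.2 ∈ f w := by
      obtain ⟨w, hw, hx⟩ := Part.mem_bind_iff.1 x.2
      exact ⟨w, get_mem_of_mem_mOfFn hw, hx⟩
    choose w hw hx using key
    refine ProgComputable.trans (Y := fun x => encVector (w x)) ?_
      (ihf.reindex fun x => ⟨(w x, x.1.2), hx x⟩)
    simp only [encVector_eq_ofFn (w _)]
    exact ProgComputable.ofFn fun k => (ihg k).reindex fun x => ⟨(x.1.1, (w x).get k), hw x k⟩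
  | @rfind n f _ ihf =>
    let I := {x : List.Vector ℕ n × ℕ // x.2 ∈ Nat.rfind fun j => some (decide (f (j ::ᵥ x.1) = 0))}
    have hstep : ProgComputable (fun j : I × ℕ => encVector (j.2 ::ᵥ j.1.1.1))
        fun j => .ofNat (f (j.2 ::ᵥ j.1.1.1)) :=
      ihf.reindex fun j : I × ℕ => ⟨(j.2 ::ᵥ j.1.1.1, f (j.2 ::ᵥ j.1.1.1)), by simp⟩
    have hX := ProgComputable.self (X := fun x : I => encVector x.1.1)
    -- The search state starts with the value of `f` at the candidate `j`. Zero is encoded as `nil`,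
    -- so this value is itself the loop flag.
    have h := ProgComputable.find (X := fun x : I => encVector x.1.1) (N := fun x => x.1.2)
      (st := fun x j => .cons (.ofNat (f (j ::ᵥ x.1.1))) (.cons (.ofNat j) (encVector x.1.1)))
      (ProgComputable.cons (ProgComputable.trans (by
          simpa [encVector_cons, Tree.ofNat] using ProgComputable.nil.cons hX)
        (hstep.reindex fun x : I => (x, 0))) (ProgComputable.nil.cons hX))
      (by
        have hS := ProgComputable.self (X := fun j : {j : I × ℕ // j.2 < j.1.1.2} =>
          .cons (.ofNat (f (j.1.2 ::ᵥ j.1.1.1.1))) (.cons (.ofNat j.1.2) (encVector j.1.1.1.1)))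
        have h1 := (ProgComputable.nil.cons hS.tail.head).cons hS.tail.tail
        refine ProgComputable.cons (ProgComputable.trans (by
          simpa [encVector_cons, Tree.ofNat] using h1)
          (hstep.reindex fun j : {j : I × ℕ // j.2 < j.1.1.2} => (j.1.1, j.1.2 + 1))) h1)
      (fun x => by
        have := Nat.rfind_spec x.2
        simp only [Part.coe_some, Part.mem_some_iff] at this
        have := of_decide_eq_true this.symm
        simp [this, Tree.ofNat])
      (fun x j hj => by
        have := Nat.rfind_min x.2 hj
        simp only [Part.coe_some, Part.mem_some_iff] at this
        have := of_decide_eq_false this.symm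
        obtain ⟨d, hd⟩ := Nat.exists_eq_succ_of_ne_zero this
        simp [hd, Tree.ofNat])
    exact h.tail.head

theorem progComputable_of_computable {f : ℕ → ℕ} (hf : Computable f) :
    ProgComputable Tree.ofNat fun k => .ofNat (f k) := by
  have h := progComputable_of_partrec' (Nat.Partrec'.part_iff₁.2 hf)
  refine ProgComputable.trans (Y := fun k => encVector (k ::ᵥ List.Vector.nil)) ?_
    (h.reindex fun k => ⟨(k ::ᵥ List.Vector.nil, f k), by simp⟩)
  simpa [encVector, Tree.ofList] using
    (ProgComputable.self (X := Tree.ofNat)).cons .nil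


/-! ### Programs with a clock -/

theorem Exec.deterministic {p : Prog} {s s' : Store} {n : ℕ} (h : Exec p s n s') :
    ∀ {m : ℕ} {s'' : Store}, Exec p s m s'' → n = m ∧ s' = s'' := by
  induction h with
  | assign x e s => intro m s'' h'; cases h'; exact ⟨rfl, rfl⟩
  | seq _ _ ih1 ih2 =>
    intro m s'' h'
    cases h' with
    | seq h1 h2 =>
      obtain ⟨rfl, rfl⟩ := ih1 h1
      obtain ⟨rfl, rfl⟩ := ih2 h2
      exact ⟨rfl, rfl⟩
  | ite_true hx _ ih =>
    intro m s'' h'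
    cases h' with
    | ite_true _ h => obtain ⟨rfl, rfl⟩ := ih h; exact ⟨rfl, rfl⟩
    | ite_false hx' _ => exact absurd hx' hx
  | ite_false hx _ ih =>
    intro m s'' h'
    cases h' with
    | ite_true hx' _ => exact absurd hx hx'
    | ite_false _ h => obtain ⟨rfl, rfl⟩ := ih h; exact ⟨rfl, rfl⟩
  | loop_stop hx =>
    intro m s'' h'
    cases h' with
    | loop_stop _ => exact ⟨rfl, rfl⟩
    | loop_step hx' _ _ => exact absurd hx hx'
  | loop_step hx _ _ ih1 ih2 =>
    intro m s'' h'
    cases h' with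
    | loop_stop hx' => exact absurd hx' hx
    | loop_step _ h1 h2 =>
      obtain ⟨rfl, rfl⟩ := ih1 h1
      obtain ⟨rfl, rfl⟩ := ih2 h2
      exact ⟨rfl, rfl⟩

theorem Computes.unique {p : Prog} {x y y' : Tree} {n n' : ℕ} (h : Computes p x n y)
    (h' : Computes p x n' y') : y = y' := by
  obtain ⟨s, h1, rfl⟩ := h
  obtain ⟨s', h1', rfl⟩ := h'
  rw [(h1.deterministic h1').2]

/-- The height of a tree. -/
def Tree.depth : Tree → ℕ
  | .nil => 0
  | .cons a b => max a.depth b.depth + 1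

theorem Tree.depth_ofNat (n : ℕ) : (ofNat n).depth = n := by
  induction n with
  | zero => rfl
  | succ n ih => simp [ofNat, depth, ih]

/-- One `cons` may double the size of a tree but raises its height by only one. Since a unary number
has its value as height, a short computation cannot produce a large number. -/
theorem Exec.depth_le {p : Prog} {s s' : Store} {n : ℕ} (h : Exec p s n s') :
    ∀ {B : ℕ}, (∀ x, (s x).depth ≤ B) → ∀ x, (s' x).depth ≤ B + n := by
  induction h with
  | assign x e s =>
    intro B hB y
    by_cases hy : y = x
    · subst hy
      rw [Function.update_self]
      have hh (t : Tree) : t.head.depth ≤ t.depth ∧ t.tail.depth ≤ t.depth := by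
        cases t <;> simp [Tree.head, Tree.tail, Tree.depth]; omega
      cases e with
      | nil => simp [Expr.eval, Tree.depth]
      | var z => exact (hB z).trans (by omega)
      | cons z w =>
        have := hB z
        have := hB w
        simp only [Expr.eval, Tree.depth]; omega
      | head z => exact ((hh _).1.trans (hB z)).trans (by omega)
      | tail z => exact ((hh _).2.trans (hB z)).trans (by omega)
    · rw [Function.update_of_ne hy]
      exact (hB y).trans (by omega)
  | seq _ _ ih1 ih2 =>
    intro B hB x
    exact (ih2 (ih1 hB) x).trans (by omega)
  | ite_true _ _ ih => intro B hB x; exact (ih hB x).trans (by omega)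
  | ite_false _ _ ih => intro B hB x; exact (ih hB x).trans (by omega)
  | loop_stop _ => intro B hB x; exact (hB x).trans (by omega)
  | loop_step _ _ _ ih1 ih2 =>
    intro B hB x
    exact (ih2 (ih1 hB) x).trans (by omega)

theorem Computes.depth_le {p : Prog} {x y : Tree} {n : ℕ} (h : Computes p x n y) :
    y.depth ≤ x.depth + n := by
  obtain ⟨s, h1, rfl⟩ := h
  refine h1.depth_le (fun z => ?_) 0
  rcases Nat.eq_zero_or_pos z with rfl | hz
  · simp [initStore]
  · simp [initStore_of_pos x hz, Tree.depth]

/-- Copies variable `x` of a clocked program to the flag, unless the fuel is used up. -/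
def Prog.probe (x : ℕ) : Prog := .ite 0 (.assign 1 (.var (x + 2))) (.assign 1 .nil)

/-- The program with a clock: variable `0` holds the fuel, one unit of which is used by each
elementary step, variable `1` is a flag, and the other variables are shifted. When the fuel is used
up, nothing happens any more. -/
def Prog.clock : Prog → Prog
  | .assign x e => .ite 0 (.seq (.assign 0 (.tail 0)) (.assign (x + 2) (e.rename (· + 2))))
      (.assign 1 .nil)
  | .seq p p' => .seq p.clock p'.clock
  | .ite x p p' => .ite 0 (.seq (.assign 0 (.tail 0)) (.ite (x + 2) p.clock p'.clock))
      (.assign 1 .nil)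
  | .loop x p => .seq (.probe x)
      (.loop 1 (.seq (.assign 0 (.tail 0)) (.seq p.clock (.probe x))))

/-- The store of the original program inside the store of the clocked one. -/
def Store.shift (u : Store) : Store := fun x => u (x + 2)

theorem shift_update_zero (u : Store) (t : Tree) :
    Store.shift (Function.update u 0 t) = Store.shift u := by
  funext x; simp [Store.shift]

theorem shift_update_one (u : Store) (t : Tree) :
    Store.shift (Function.update u 1 t) = Store.shift u := by
  funext x; simp [Store.shift]

theorem Exec.probe {F : ℕ} {u : Store} (hu : u 0 = .ofNat F) (x : ℕ) :
    Exec (.probe x) u 2 (Function.update u 1 (if F = 0 then .nil else u (x + 2))) := by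
  rcases F with _ | F
  · exact .ite_false hu (.assign _ _ _)
  · exact .ite_true (by simp [hu, Tree.ofNat]) (.assign _ _ _)

/-- What is to be shown about a clocked program `c` for `p`. -/
def ClockSpec (p c : Prog) (A B F : ℕ) (u : Store) : Prop :=
  ∃ (n F' : ℕ) (u' : Store), Exec c u n u' ∧ u' 0 = .ofNat F' ∧ F' ≤ F ∧
    -- Amortized time: each unit of fuel consumed pays for `A` steps, with overhead `B`. Fuel left
    -- over means that `p` really ran to its end, and a run of `p` with `m` steps consumes at most
    -- `m` units.
    n + A * F' ≤ A * F + B ∧ (F' ≠ 0 → ∃ m ≤ n, Exec p u.shift m u'.shift) ∧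
    ∀ m s, Exec p u.shift m s → F ≤ F' + m

theorem ClockSpec.mono {p c : Prog} {A A' B B' F : ℕ} {u : Store} (h : ClockSpec p c A B F u)
    (hA : A ≤ A') (hB : B ≤ B') : ClockSpec p c A' B' F u := by
  obtain ⟨n, F', u', h1, h2, h3, h4, h5⟩ := h
  refine ⟨n, F', u', h1, h2, h3, ?_, h5⟩
  obtain ⟨d, rfl⟩ := Nat.exists_eq_add_of_le hA
  have := Nat.mul_le_mul_left d h3
  rw [add_mul, add_mul]
  omega

/-- The induction is on the fuel, since `p` need not halt. Every iteration spends a unit on its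
test, and this unit pays for the overhead `B` of the body and the bookkeeping. -/
theorem clockSpec_loop {p : Prog} {A B : ℕ}
    (ih : ∀ F u, u 0 = Tree.ofNat F → ClockSpec p p.clock A B F u) (x : ℕ) :
    ∀ F u, u 0 = Tree.ofNat F → u 1 = (if F = 0 then .nil else u (x + 2)) →
      ClockSpec (.loop x p) (.loop 1 (.seq (.assign 0 (.tail 0)) (.seq p.clock (.probe x))))
        (A + B + 5) 1 F u := by
  intro F
  induction F using Nat.strong_induction_on with
  | _ F IH =>
    intro u hu0 hu1
    by_cases hx : u 1 = .nil
    · refine ⟨1, F, u, Exec.loop_stop hx, hu0, le_rfl, by omega, fun hF => ⟨1, le_rfl, ?_⟩,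
        fun m s _ => by omega⟩
      rw [if_neg hF] at hu1
      exact Exec.loop_stop (by rw [Store.shift, ← hu1, hx])
    · have hF : F ≠ 0 := by rintro rfl; exact hx (by simpa using hu1)
      rw [if_neg hF] at hu1
      obtain ⟨F, rfl⟩ := Nat.exists_eq_succ_of_ne_zero hF
      obtain ⟨n1, F1, u1, a1, a2, a3, a4, a5, a6⟩ := ih F (Function.update u 0 (.ofNat F)) (by simp)
      rw [shift_update_zero] at a5 a6
      obtain ⟨n2, F', u', b1, b2, b3, b4, b5, b6⟩ := IH F1 (by omega)
        (Function.update u1 1 (if F1 = 0 then .nil else u1 (x + 2))) (by simp [a2]) (by simp)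
      rw [shift_update_one] at b5 b6
      have hx' : u.shift x ≠ .nil := by rwa [Store.shift, ← hu1]
      have e1 : Exec (.assign 0 (.tail 0)) u 1 (Function.update u 0 (.ofNat F)) := by
        have := Exec.assign 0 (.tail 0) u
        rwa [Expr.eval, hu0] at this
      refine ⟨_, F', u', .loop_step hx (.seq e1 (.seq a1 (.probe a2 x))) b1, b2, by omega, ?_,
        fun h => ?_, fun m s h => ?_⟩
      · have h1 := Nat.mul_le_mul_left (B + 5) a3
        simp only [add_mul, mul_add, Nat.succ_eq_add_one] at *
        omega
      · obtain ⟨m1, c1, c2⟩ := a5 (by omega)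
        obtain ⟨m2, d1, d2⟩ := b5 h
        exact ⟨m1 + m2 + 1, by omega, .loop_step hx' c2 d2⟩
      · cases h with
        | loop_stop h => exact absurd h hx'
        | @loop_step _ _ _ s1 _ m1 m2 _ h1 h2 =>
          have c1 := a6 _ _ h1
          rcases Nat.eq_zero_or_pos F1 with h0 | h0
          · omega
          · obtain ⟨m', -, c2⟩ := a5 (by omega)
            obtain ⟨-, rfl⟩ := c2.deterministic h1
            have := b6 _ _ h2
            omega

theorem exists_clockSpec (p : Prog) :
    ∃ A B, ∀ F u, u 0 = Tree.ofNat F → ClockSpec p p.clock A B F u := by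
  induction p with
  | assign x e =>
    refine ⟨0, 3, fun F u hu => ?_⟩
    rcases F with _ | F
    · exact ⟨_, 0, _, .ite_false hu (.assign _ _ _), by simp [hu], le_rfl, by omega,
        fun h => absurd rfl h, fun _ _ _ => by omega⟩
    · refine ⟨_, F, _, .ite_true (by simp [hu, Tree.ofNat]) (.seq (.assign _ _ _)
        (.assign _ _ _)), by simp [hu, Expr.eval, Tree.ofNat], by omega, by omega,
        fun _ => ⟨1, by omega, ?_⟩, fun m s h => ?_⟩
      · have := Exec.assign x e u.shift
        refine cast ?_ this
        congr 1
        rw [Expr.eval_rename]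
        funext y
        have h1 : (fun x => Function.update u 0 (Expr.eval u (Expr.tail 0)) (x + 2)) = u.shift :=
          shift_update_zero _ _
        rw [h1]
        by_cases hy : y = x
        · subst hy; simp [Store.shift]
        · simp [Store.shift, Function.update_of_ne hy,
            Function.update_of_ne (show y + 2 ≠ x + 2 by omega)]
      · cases h
        omega
  | seq p q ihp ihq =>
    obtain ⟨A1, B1, h1⟩ := ihp
    obtain ⟨A2, B2, h2⟩ := ihq
    refine ⟨A1 + A2, B1 + B2, fun F u hu => ?_⟩
    obtain ⟨n1, F1, u1, a1, a2, a3, a4, a5, a6⟩ :=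
      (h1 F u hu).mono (Nat.le_add_right A1 A2) le_rfl
    obtain ⟨n2, F2, u2, b1, b2, b3, b4, b5, b6⟩ :=
      (h2 F1 u1 a2).mono (Nat.le_add_left A2 A1) le_rfl
    refine ⟨_, F2, u2, .seq a1 b1, b2, b3.trans a3, by omega, fun h => ?_, fun m s h => ?_⟩
    · obtain ⟨m1, c1, c2⟩ := a5 (by omega)
      obtain ⟨m2, d1, d2⟩ := b5 h
      exact ⟨_, add_le_add c1 d1, .seq c2 d2⟩
    · cases h with
      | seq c1 c2 =>
        have := a6 _ _ c1
        rcases Nat.eq_zero_or_pos F1 with h0 | h0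
        · omega
        · obtain ⟨m', -, d⟩ := a5 (by omega)
          obtain ⟨-, rfl⟩ := d.deterministic c1
          have := b6 _ _ c2
          omega
  | ite x p q ihp ihq =>
    obtain ⟨A1, B1, h1⟩ := ihp
    obtain ⟨A2, B2, h2⟩ := ihq
    refine ⟨A1 + A2, B1 + B2 + 4, fun F u hu => ?_⟩
    rcases F with _ | F
    · exact ⟨_, 0, _, .ite_false hu (.assign _ _ _), by simp [hu], le_rfl, by omega,
        fun h => absurd rfl h, fun _ _ _ => by omega⟩
    have e1 : Exec (.assign 0 (.tail 0)) u 1 (Function.update u 0 (.ofNat F)) := by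
      have := Exec.assign 0 (.tail 0) u
      rwa [Expr.eval, hu] at this
    have hne : u 0 ≠ .nil := by simp [hu, Tree.ofNat]
    by_cases hx : u (x + 2) = .nil
    · obtain ⟨n1, F1, u1, a1, a2, a3, a4, a5, a6⟩ :=
        (h2 F (Function.update u 0 (.ofNat F)) (by simp)).mono (Nat.le_add_left A2 A1) le_rfl
      rw [shift_update_zero] at a5 a6
      refine ⟨_, F1, u1, .ite_true hne (.seq e1 (.ite_false (by simpa using hx) a1)), a2,
        by omega, by rw [mul_add]; omega, fun h => ?_, fun m s h => ?_⟩
      · obtain ⟨m, c1, c2⟩ := a5 h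
        exact ⟨m + 1, by omega, .ite_false hx c2⟩
      · cases h with
        | ite_true h _ => exact absurd hx h
        | ite_false _ h => have := a6 _ _ h; omega
    · obtain ⟨n1, F1, u1, a1, a2, a3, a4, a5, a6⟩ :=
        (h1 F (Function.update u 0 (.ofNat F)) (by simp)).mono (Nat.le_add_right A1 A2) le_rfl
      rw [shift_update_zero] at a5 a6
      refine ⟨_, F1, u1, .ite_true hne (.seq e1 (.ite_true (by simpa using hx) a1)), a2,
        by omega, by rw [mul_add]; omega, fun h => ?_, fun m s h => ?_⟩
      · obtain ⟨m, c1, c2⟩ := a5 h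
        exact ⟨m + 1, by omega, .ite_true hx c2⟩
      · cases h with
        | ite_false h _ => exact absurd h hx
        | ite_true _ h => have := a6 _ _ h; omega
  | loop x p ih =>
    obtain ⟨A, B, h⟩ := ih
    refine ⟨A + B + 5, 3, fun F u hu => ?_⟩
    obtain ⟨n, F', u', a1, a2, a3, a4, a5, a6⟩ := clockSpec_loop h x F
      (Function.update u 1 (if F = 0 then .nil else u (x + 2))) (by simp [hu]) (by simp)
    rw [shift_update_one] at a5 a6
    refine ⟨_, F', u', .seq (.probe hu x) a1, a2, a3, by omega, fun h => ?_, a6⟩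
    obtain ⟨m, c1, c2⟩ := a5 h
    exact ⟨m, by omega, c2⟩

/-- A program can be run for a limited time: with the fuel `F`, the result is `nil` if the
computation has been aborted. -/
theorem exists_timed (p : Prog) : ∃ (q : Prog) (c : ℕ), ∀ (F : ℕ) (x : Tree), ∃ (n : ℕ) (o : Tree),
    n ≤ c * (F + 1) ∧ Run q (.cons (.ofNat F) x) n o ∧
    (o = .nil ∨ ∃ m y, m ≤ c * (F + 1) ∧ Computes p x m y ∧ o = .cons y .nil) ∧
    ∀ m y, Computes p x m y → m < F → o ≠ .nil := by
  obtain ⟨A, B, h⟩ := exists_clockSpec p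
  -- Variable `2` plays the role of variable `0` of `p`. The result is wrapped in a `cons`, to tell
  -- it from the abort signal `nil`. A run that just exhausts its fuel counts as aborted, hence the
  -- strict `m < F`.
  let q : Prog := .seq (.assign 2 (.tail 0)) (.seq (.assign 0 (.head 0)) (.seq p.clock
    (.ite 0 (.seq (.assign 1 .nil) (.assign 0 (.cons 2 1))) (.assign 1 .nil))))
  refine ⟨q.tidy, A + B + q.bound + 6, fun F x => ?_⟩
  let u : Store := Function.update (Function.update (initStore (.cons (.ofNat F) x)) 2 x) 0
    (.ofNat F)
  have hu : u.shift = initStore x := by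
    funext y
    rcases y with _ | y
    · simp [u, Store.shift, initStore]
    · simp [u, Store.shift, initStore]
  obtain ⟨n, F', u', a1, a2, a3, a4, a5, a6⟩ := h F u (by simp [u])
  rw [hu] at a5 a6
  have hb1 : n ≤ A * F + B := by omega
  have hb2 : (A + B + q.bound + 6) * (F + 1) =
    A * F + A + B * F + B + (q.bound + 6) * F + q.bound + 6 := by ring
  have hq : ∃ (m : ℕ) (v : Store), m ≤ n + 5 ∧ Exec q (initStore (.cons (.ofNat F) x)) m v ∧
      v 0 = if F' = 0 then .nil else .cons (u'.shift 0) .nil := by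
    have e0 : Exec (.assign 2 (.tail 0)) (initStore (.cons (.ofNat F) x)) 1
        (Function.update (initStore (.cons (.ofNat F) x)) 2 x) := .assign _ _ _
    have e1 : Exec (.assign 0 (.head 0)) (Function.update (initStore (.cons (.ofNat F) x)) 2 x) 1
        u := by
      convert Exec.assign 0 (.head 0) (Function.update (initStore (.cons (.ofNat F) x)) 2 x)
        using 1
      simp [u, Expr.eval, initStore]
    rcases F' with _ | F'
    · refine ⟨_, _, ?_, .seq e0 (.seq e1 (.seq a1 (.ite_false a2 (.assign _ _ _)))), by simp [a2,
        Tree.ofNat]⟩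
      omega
    · refine ⟨_, _, ?_, .seq e0 (.seq e1 (.seq a1 (.ite_true (by simp [a2, Tree.ofNat])
        (.seq (.assign _ _ _) (.assign _ _ _))))), by simp [Expr.eval, Store.shift]⟩
      omega
  obtain ⟨m, v, h1, h2, h3⟩ := hq
  refine ⟨_, _, ?_, Computes.tidy ⟨v, h2, rfl⟩, ?_, fun m' y hm hlt => ?_⟩
  · rw [hb2]
    omega
  · rw [h3]
    by_cases hF : F' = 0
    · exact .inl (by simp [hF])
    · obtain ⟨m', c1, c2⟩ := a5 hF
      exact .inr ⟨m', _, by rw [hb2]; omega, ⟨_, c2, rfl⟩, by simp [hF]⟩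
  · obtain ⟨s, hs, rfl⟩ := hm
    have := a6 _ _ hs
    have hF : F' ≠ 0 := by omega
    rw [h3]
    simp [hF]

/-! ### Slowly growing functions -/

/-- A computation may be run for `F` steps in time polynomial in `F`. -/
theorem exists_polyTime_timed {D T : ℕ → ℕ}
    (h : ProgComputable Tree.ofNat fun k => .cons (.ofNat (D k)) (.ofNat (T k))) :
    ∃ (ok : ℕ → ℕ → Bool) (c : ℕ), (∀ k, ∃ F₀, ∀ F ≥ F₀, ok F k) ∧
      (∀ F k, ok F k → D k ≤ c * (F + k + 1) ∧ T k ≤ c * (F + k + 1)) ∧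
      PolyTime (ι := ℕ × ℕ) (fun j => j.1 + j.2) (fun j => .cons (.ofNat j.1) (.ofNat j.2))
        (fun j => if ok j.1 j.2 then .cons (.cons (.ofNat (D j.2)) (.ofNat (T j.2))) .nil
          else .nil) := by
  classical
  obtain ⟨p, hp⟩ := h
  obtain ⟨q, c, hq⟩ := exists_timed p
  choose n o hn hr ho hlt using hq
  have hne (F k : ℕ) (h : o F (.ofNat k) ≠ .nil) :
      o F (.ofNat k) = .cons (.cons (.ofNat (D k)) (.ofNat (T k))) .nil ∧
        D k ≤ (c + 1) * (F + k + 1) ∧ T k ≤ (c + 1) * (F + k + 1) := by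
    obtain h0 | ⟨m, y, h1, h2, h3⟩ := ho F (.ofNat k)
    · exact absurd h0 h
    · obtain ⟨m', hm'⟩ := hp k
      obtain rfl := h2.unique hm'.computes
      -- The answer arises in at most `c * (F + 1)` steps from an input of height `k`, so its
      -- height, and with it `D k` and `T k`, is linear in `F + k`.
      have h4 := h2.depth_le
      simp only [Tree.depth, Tree.depth_ofNat] at h4
      have h5 : (c + 1) * (F + k + 1) = c * (F + 1) + c * k + F + k + 1 := by ring
      refine ⟨h3, ?_, ?_⟩ <;> omega
  have hok (F k : ℕ) : (if decide (o F (.ofNat k) ≠ .nil) = true then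
      .cons (.cons (.ofNat (D k)) (.ofNat (T k))) .nil else .nil) = o F (.ofNat k) := by
    by_cases h : o F (.ofNat k) = .nil
    · simp [h]
    · simp [(hne F k h).1]
  refine ⟨fun F k => decide (o F (.ofNat k) ≠ .nil), c + 1, fun k => ?_,
    fun F k h => (hne F k (of_decide_eq_true h)).2, ?_⟩
  · obtain ⟨m, hm⟩ := hp k
    exact ⟨m + 1, fun F hF => decide_eq_true (hlt F _ m _ hm.computes (by omega))⟩
  · refine ⟨q, fun j => c * (j.1 + 1), ?_, fun j => ⟨n j.1 (.ofNat j.2), hn _ _, ?_⟩, ?_⟩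
    · exact ((PolyBdd.const c).mul (PolyBdd.self.add (.const 1))).mono fun j => by
        gcongr; omega
    · convert hr j.1 (.ofNat j.2) using 1
      convert hok j.1 j.2
    · refine ((((PolyBdd.const (4 * (c + 1))).mul (PolyBdd.self.add (.const 1)))).add
        (.const 5)).mono fun j => ?_
      dsimp only
      split_ifs with h
      · obtain ⟨-, h1, h2⟩ := hne _ _ (of_decide_eq_true h)
        simp only [Tree.size, Tree.size_ofNat, mul_assoc]
        omega
      · simp [Tree.size]

/-- `κ q` is the largest `k` with `1 ≤ k ≤ q` for which `D k` and `T k` are obtained under a clock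
of `q` units, or `1` if there is none. Each `k` succeeds once `q` is large, so `κ` tends to
infinity, and values found by clocked runs are linear in `q`. The values at the default `1` are
constants, built into the program. -/
theorem exists_slow {D T : ℕ → ℕ} (hD : Computable D) (hT : Computable T) :
    ∃ (κ : ℕ → ℕ) (c : ℕ), (∀ q, 1 ≤ κ q) ∧ (∀ q, κ q ≤ q + 1) ∧ Tendsto κ atTop atTop ∧
      (∀ q, D (κ q) ≤ c * (q + 1)) ∧ (∀ q, T (κ q) ≤ c * (q + 1)) ∧
      PolyTime (fun q => q) Tree.ofNat
        (fun q => .cons (.ofNat (κ q)) (.ofNat (D (κ q)))) := by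
  obtain ⟨ok, c, h1, h2, h3⟩ := exists_polyTime_timed
    ((progComputable_of_computable hD).cons (progComputable_of_computable hT))
  let K : ℕ → ℕ → ℕ := fun q j => Nat.rec 1 (fun j k => if ok q (j + 1) then j + 1 else k) j
  have hK (q j : ℕ) : K q (j + 1) = if ok q (j + 1) then j + 1 else K q j := rfl
  have hK1 (q j : ℕ) : 1 ≤ K q j := by
    induction j with
    | zero => exact le_rfl
    | succ j ih => rw [hK]; split_ifs <;> omega
  have hK2 (q j : ℕ) : K q j ≤ j + 1 := by
    induction j with
    | zero => exact le_rfl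
    | succ j ih => rw [hK]; split_ifs <;> omega
  have hK3 (q j : ℕ) : K q j = 1 ∨ (ok q (K q j) ∧ K q j ≤ j) := by
    induction j with
    | zero => exact .inl rfl
    | succ j ih =>
      rw [hK]
      split_ifs with h
      · exact .inr ⟨h, le_rfl⟩
      · exact ih.imp_right fun h => ⟨h.1, by omega⟩
  have hK4 (q k : ℕ) (hk : ok q k) (j : ℕ) (hj : k ≤ j) : k ≤ K q j := by
    induction j with
    | zero => omega
    | succ j ih =>
      rw [hK]
      split_ifs with h
      · exact hj
      · rcases hj.eq_or_lt with rfl | hj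
        · exact absurd hk h
        · exact ih (by omega)
  have hDT (q j : ℕ) (hj : j ≤ q) : D (K q j) ≤ (2 * c + D 1 + T 1) * (q + 1) ∧
      T (K q j) ≤ (2 * c + D 1 + T 1) * (q + 1) := by
    have e : (2 * c + D 1 + T 1) * (q + 1) =
      c * (q + q + 1) + c + (D 1 + T 1) + (D 1 + T 1) * q := by ring
    rcases hK3 q j with h | ⟨h, h'⟩
    · rw [h]; omega
    · have := h2 q _ h
      have : c * (q + K q j + 1) ≤ c * (q + q + 1) := by gcongr; omega
      omega
  refine ⟨fun q => K q q, 2 * c + D 1 + T 1, fun q => hK1 q q, fun q => hK2 q q, ?_,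
    fun q => (hDT q q le_rfl).1, fun q => (hDT q q le_rfl).2, ?_⟩
  · rw [tendsto_atTop]
    intro k
    obtain ⟨F₀, hF⟩ := h1 k
    filter_upwards [eventually_ge_atTop F₀, eventually_ge_atTop k] with q hq hq'
    exact hK4 q k (hF q hq) q hq'
  · have hX : PolyBdd (fun q => q) fun q => (Tree.ofNat q).size :=
      (((PolyBdd.const 2).mul .self).add (.const 1)).mono fun q => (Tree.size_ofNat q).le
    have hs : PolyBdd (ι := {j : ℕ × ℕ // j.2 < j.1}) (fun j => j.1.1) fun j =>
        (Tree.cons (.ofNat j.1.2) (.cons (.ofNat (K j.1.1 j.1.2))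
          (.ofNat (D (K j.1.1 j.1.2))))).size := by
      refine ((PolyBdd.const (2 * (2 * c + D 1 + T 1) + 8)).mul
        (PolyBdd.self.add (.const 1))).mono fun j => ?_
      have a1 := j.2
      have a2 := hK2 j.1.1 j.1.2
      have a3 := (hDT j.1.1 j.1.2 j.2.le).1
      simp only [Tree.size, Tree.size_ofNat]
      rw [add_mul, mul_assoc]
      omega
    have := PolyTime.fold_nat (n := fun q => q) (st := fun q j => .cons (.ofNat j)
      (.cons (.ofNat (K q j)) (.ofNat (D (K q j))))) hX (.id hX)
      (PolyTime.const (.cons (.ofNat 0) (.cons (.ofNat 1) (.ofNat (D 1))))) hs (by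
        have a := PolyTime.arg hX hs
        have x := PolyTime.lift hX hs (.id hX)
        have t := PolyTime.trans_reindex
          (fun j : {j : ℕ × ℕ // j.2 < j.1} => (j.1.1, j.1.2 + 1))
          (x.cons (PolyTime.nil.cons a.head)) h3
          (((PolyBdd.const 2).mul .self).mono fun j => by have := j.2; dsimp only; omega)
        refine cast ?_ ((PolyTime.nil.cons a.head).cons (t.cond
          ((PolyTime.nil.cons a.head).cons t.head.head) a.tail))
        congr 1; funext j
        rw [hK]
        by_cases h : ok j.1.1 (j.1.2 + 1) = true
        · simp [h, Tree.ofNat]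
        · simp [h, Tree.ofNat])
    exact this.tail


/-! ### The reduction -/

/-- Vertices of the reduction: the class of the vertex, a partial assignment (given by its true
literals), and a clause. -/
abbrev Vertex : Type := ℕ × List (ℕ × Bool) × Option ((ℕ × Bool) × (ℕ × Bool) × (ℕ × Bool))

/-- The partial assignment of `u` satisfies the clause of `v`. -/
def Vertex.sat (u v : Vertex) : Bool :=
  match v.2.2 with
  | none => false
  | some C => u.2.1.any fun l => decide (l = C.1) || (decide (l = C.2.1) || decide (l = C.2.2))

/-- Adjacency of numbered vertices: the classes are cliques, and otherwise partial assignments are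
adjacent to the clauses that they satisfy. -/
def Vertex.adj (u v : Vertex × ℕ) : Bool :=
  if u.1.1 = v.1.1 then !decide (u.2 = v.2) else (Vertex.sat u.1 v.1 || Vertex.sat v.1 u.1)

theorem Vertex.adj_comm (u v : Vertex × ℕ) : Vertex.adj u v = Vertex.adj v u := by
  simp only [Vertex.adj, eq_comm, Bool.or_comm]

theorem Vertex.adj_self (u : Vertex × ℕ) : Vertex.adj u u = false := by
  simp [Vertex.adj]

/-- The graph on a list of vertices. -/
def vertexGraph (W : List Vertex) : SimpleGraph (Fin W.length) where
  Adj i j := Vertex.adj (W[i], i) (W[j], j) = true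
  symm := ⟨fun i j h => by rwa [Vertex.adj_comm]⟩
  loopless := ⟨fun i h => by simp [Vertex.adj_self] at h⟩

theorem vertexGraph_adj_of_class_eq {W : List Vertex} {i j : Fin W.length}
    (h : W[i].1 = W[j].1) (hne : i ≠ j) : (vertexGraph W).Adj i j := by
  simp only [vertexGraph, Vertex.adj, if_pos h]
  simpa using fun h => hne (Fin.ext h)

theorem vertexGraph_adj_iff_of_class_ne {W : List Vertex} {i j : Fin W.length}
    (h : W[i].1 ≠ W[j].1) :
    (vertexGraph W).Adj i j ↔ Vertex.sat W[i] W[j] = true ∨ Vertex.sat W[j] W[i] = true := by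
  simp only [vertexGraph, Vertex.adj, if_neg h, Bool.or_eq_true]

/-- All assignments of the variables below `q` in the residue class of `i` modulo `k`. -/
def tables (k i : ℕ) : ℕ → List (List (ℕ × Bool))
  | 0 => [[]]
  | q + 1 => if q % k = i then (tables k i q).map (List.cons (q, true)) ++
      (tables k i q).map (List.cons (q, false)) else tables k i q

/-- A table is consistent in itself, and tables of different groups concern disjoint sets of
variables. So tables chosen one per group never contradict each other. -/
theorem mem_tables {k i q : ℕ} {T : List (ℕ × Bool)} (h : T ∈ tables k i q) :
    (∀ l ∈ T, l.1 % k = i ∧ l.1 < q) ∧ (∀ x b b', (x, b) ∈ T → (x, b') ∈ T → b = b') ∧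
      T.length ≤ q := by
  induction q generalizing T with
  | zero =>
    simp only [tables, List.mem_singleton] at h
    subst h
    simp
  | succ q ih =>
    rw [tables] at h
    split_ifs at h with hq
    · have : ∃ b, ∃ T' ∈ tables k i q, T = (q, b) :: T' := by
        rcases List.mem_append.1 h with h | h <;>
        · obtain ⟨T', hT', rfl⟩ := List.mem_map.1 h
          exact ⟨_, T', hT', rfl⟩
      obtain ⟨b, T', hT', rfl⟩ := this
      obtain ⟨h1, h2, h3⟩ := ih hT'
      refine ⟨?_, ?_, by simpa using h3⟩
      · intro l hl
        rcases List.mem_cons.1 hl with rfl | hl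
        · exact ⟨hq, by simp⟩
        · exact ⟨(h1 l hl).1, (h1 l hl).2.trans (Nat.lt_succ_self q)⟩
      · intro x c c' hc hc'
        rcases List.mem_cons.1 hc with hc | hc <;> rcases List.mem_cons.1 hc' with hc' | hc'
        · simp only [Prod.mk.injEq] at hc hc'
          rw [hc.2, hc'.2]
        · have := (h1 _ hc').2
          simp only [Prod.mk.injEq] at hc this
          omega
        · have := (h1 _ hc).2
          simp only [Prod.mk.injEq] at hc' this
          omega
        · exact h2 x c c' hc hc'
    · obtain ⟨h1, h2, h3⟩ := ih h
      exact ⟨fun l hl => ⟨(h1 l hl).1, (h1 l hl).2.trans (Nat.lt_succ_self q)⟩, h2, by omega⟩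

theorem exists_mem_tables (k i q : ℕ) (τ : ℕ → Bool) :
    ∃ T ∈ tables k i q, ∀ x < q, x % k = i → (x, τ x) ∈ T := by
  induction q with
  | zero => exact ⟨[], by simp [tables], by simp⟩
  | succ q ih =>
    obtain ⟨T, hT, h⟩ := ih
    rw [tables]
    split_ifs with hq
    · refine ⟨(q, τ q) :: T, ?_, fun x hx hxi => ?_⟩
      · cases τ q <;> simp [hT]
      · rcases (Nat.lt_succ_iff.1 hx).eq_or_lt with rfl | hx
        · exact List.mem_cons_self
        · exact List.mem_cons_of_mem _ (h x hx hxi)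
    · refine ⟨T, hT, fun x hx hxi => ?_⟩
      rcases (Nat.lt_succ_iff.1 hx).eq_or_lt with rfl | hx
      · exact absurd hxi hq
      · exact h x hx hxi

/-- The exponent is the number of `x < q` with `x % k = i`; the quotient jumps exactly when such an
`x` is passed. -/
theorem length_tables {k i : ℕ} (hi : i < k) (q : ℕ) :
    (tables k i q).length = 2 ^ ((q + (k - 1 - i)) / k) := by
  induction q with
  | zero =>
    rw [Nat.div_eq_of_lt (by omega)]
    rfl
  | succ q ih =>
    have hd : k ∣ q + (k - 1 - i) + 1 ↔ q % k = i := by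
      rw [show q + (k - 1 - i) + 1 = q + (k - i) by omega, Nat.dvd_iff_mod_eq_zero, Nat.add_mod]
      have h1 := Nat.mod_lt q (by omega : 0 < k)
      rcases Nat.eq_zero_or_pos i with rfl | h0
      · simp
      · rw [Nat.mod_eq_of_lt (by omega : k - i < k)]
        constructor
        · intro h
          obtain ⟨d, hd⟩ := Nat.dvd_of_mod_eq_zero h
          have hd1 : d = 1 := by
            rcases d with _ | _ | d
            · omega
            · rfl
            · have : k * (d + 1 + 1) = k * d + k + k := by ring
              have := Nat.zero_le (k * d)
              omega
          subst hd1
          omega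
        · intro h
          rw [show q % k + (k - i) = k by omega, Nat.mod_self]
    rw [tables, show q + 1 + (k - 1 - i) = q + (k - 1 - i) + 1 by ring, Nat.succ_div]
    by_cases h : q % k = i
    · rw [if_pos h, if_pos (hd.2 h), pow_succ]
      simp [ih]; ring
    · rw [if_neg h, if_neg (mt hd.1 h), ih, add_zero]

theorem length_tables_le {k i : ℕ} (hi : i < k) (q : ℕ) :
    (tables k i q).length ≤ 2 ^ (q / k + 1) := by
  rw [length_tables hi]
  refine Nat.pow_le_pow_right (by norm_num) ?_
  rw [← Nat.add_div_right q (by omega : 0 < k)]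
  exact Nat.div_le_div_right (by omega)

/-! ### The graph of a formula and the gap in its optimum -/

namespace ThreeCNF

/-- The clauses, with numbers as variables. -/
def natClauses (φ : ThreeCNF) : List ((ℕ × Bool) × (ℕ × Bool) × (ℕ × Bool)) :=
  φ.clauses.map fun C => (((C.1.1 : ℕ), C.1.2), ((C.2.1.1 : ℕ), C.2.1.2), ((C.2.2.1 : ℕ), C.2.2.2))

/-- The vertices of the reduction with `k` groups of variables and `D` copies of the clauses. -/
def vertices (φ : ThreeCNF) (k D : ℕ) : List Vertex :=
  ((List.range k).flatMap fun i => (tables k i φ.q).map fun T => (i, T, none)) ++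
    (List.range D).flatMap fun j => φ.natClauses.map fun C => (k + j, [], some C)

theorem mem_vertices {φ : ThreeCNF} {k D : ℕ} {v : Vertex} :
    v ∈ φ.vertices k D ↔ (∃ i < k, ∃ T ∈ tables k i φ.q, v = (i, T, none)) ∨
      ∃ j < D, ∃ C ∈ φ.natClauses, v = (k + j, [], some C) := by
  simp only [vertices, List.mem_append, List.mem_flatMap, List.mem_range, List.mem_map,
    @eq_comm _ v]

/-- The instance of the reduction. -/
noncomputable def reduction (φ : ThreeCNF) (k D : ℕ) : mmis.Inst :=
  ⟨(φ.vertices k D).length, vertexGraph (φ.vertices k D)⟩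

variable {φ : ThreeCNF} {k D : ℕ}

theorem exists_index {v : Vertex} (hv : v ∈ φ.vertices k D) :
    ∃ i : Fin (φ.vertices k D).length, (φ.vertices k D)[i] = v := by
  obtain ⟨i, hi, h⟩ := List.getElem_of_mem hv
  exact ⟨⟨i, hi⟩, h⟩

theorem opt_le_card {S : Finset (Fin (φ.vertices k D).length)}
    (hS : Maximal (vertexGraph (φ.vertices k D)).IsIndepSet
      (S : Set (Fin (φ.vertices k D).length))) : mmis.opt (φ.reduction k D) ≤ S.card :=
  Nat.sInf_le (m := S.card) (s := {v | ∃ S : mmis.Sol (φ.reduction k D),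
    mmis.Feasible (φ.reduction k D) S ∧ mmis.value (φ.reduction k D) S = v}) ⟨S, hS, rfl⟩

/-- Take from each group the table of a satisfying assignment. These tables are pairwise
nonadjacent; any other table shares a clique with one of them, and any clause vertex is adjacent to
the table that contains a true literal of it. -/
theorem opt_le_of_satisfiable (hk : 1 ≤ k) (h : φ.Satisfiable) :
    mmis.opt (φ.reduction k D) ≤ k := by
  obtain ⟨τ, hτ⟩ := h
  let τ' : ℕ → Bool := fun x => if hx : x < φ.q then τ ⟨x, hx⟩ else false
  have hτ' (x : Fin φ.q) : τ' x = τ x := by simp [τ']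
  have key (i : Fin k) : ∃ f : Fin (φ.vertices k D).length, ∃ T,
      (φ.vertices k D)[f] = (i.1, T, none) ∧ ∀ x < φ.q, x % k = i → (x, τ' x) ∈ T := by
    obtain ⟨T, hT, h⟩ := exists_mem_tables k i φ.q τ'
    obtain ⟨f, hf⟩ := exists_index (φ := φ) (k := k) (D := D)
      (mem_vertices.2 (.inl ⟨i, i.2, T, hT, rfl⟩))
    exact ⟨f, T, hf, h⟩
  choose f T hf hT using key
  let S : Finset (Fin (φ.vertices k D).length) := Finset.univ.image f
  have hS : Maximal (vertexGraph (φ.vertices k D)).IsIndepSet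
      (S : Set (Fin (φ.vertices k D).length)) := by
    refine ⟨?_, fun U hU hSU v hv => ?_⟩
    · intro a ha b hb hab
      simp only [S, Finset.coe_image, Finset.coe_univ, Set.image_univ, Set.mem_range] at ha hb
      obtain ⟨i, rfl⟩ := ha
      obtain ⟨j, rfl⟩ := hb
      have hij : (i : ℕ) ≠ j := fun h => hab (by rw [Fin.ext h])
      rw [vertexGraph_adj_iff_of_class_ne (by rw [hf, hf]; exact hij), hf, hf]
      simp [Vertex.sat]
    · by_contra hvS
      have hfU (i : Fin k) : f i ∈ U ∧ f i ≠ v := by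
        have : f i ∈ (S : Set _) := by simp [S]
        exact ⟨hSU this, fun h => hvS (h ▸ this)⟩
      obtain ⟨i, hi, T', hT', h⟩ | ⟨j, hj, C, hC, h⟩ :=
        mem_vertices.1 (List.getElem_mem (l := φ.vertices k D) v.2)
      · have hc : (φ.vertices k D)[f ⟨i, hi⟩].1 = (φ.vertices k D)[v].1 := by
          rw [hf]
          exact (congrArg Prod.fst h).symm
        exact hU (hfU ⟨i, hi⟩).1 hv (hfU ⟨i, hi⟩).2
          (vertexGraph_adj_of_class_eq hc (hfU ⟨i, hi⟩).2)
      · obtain ⟨C, hC', rfl⟩ := List.mem_map.1 hC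
        have hlit : ∃ l : Literal φ.q, τ l.1 = l.2 ∧ (l = C.1 ∨ l = C.2.1 ∨ l = C.2.2) := by
          rcases hτ C hC' with h | h | h
          · exact ⟨_, h, .inl rfl⟩
          · exact ⟨_, h, .inr (.inl rfl)⟩
          · exact ⟨_, h, .inr (.inr rfl)⟩
        obtain ⟨l, hl, hlC⟩ := hlit
        let i : Fin k := ⟨l.1 % k, Nat.mod_lt _ (by omega)⟩
        have h' : (φ.vertices k D)[v] = _ := h
        have hmem : ((l.1 : ℕ), l.2) ∈ T i := by
          rw [← hl, ← hτ']
          exact hT i l.1 l.1.2 rfl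
        have hc : (φ.vertices k D)[f i].1 ≠ (φ.vertices k D)[v].1 := by
          rw [hf, h']
          have := i.2
          simp only
          omega
        refine hU (hfU i).1 hv (hfU i).2 ((vertexGraph_adj_iff_of_class_ne hc).2 (.inl ?_))
        rw [hf, h']
        simp only [Vertex.sat, List.any_eq_true]
        refine ⟨_, hmem, ?_⟩
        rcases hlC with rfl | rfl | rfl <;> simp
  refine (opt_le_card hS).trans ?_
  exact Finset.card_image_le.trans (by simp)

/-- The `k + D` classes are cliques. The bound on `OPT` that follows holds for unsatisfiable
formulas too, and keeps `t(OPT)` under control for every formula. -/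
theorem card_le_of_isIndepSet {S : Finset (Fin (φ.vertices k D).length)}
    (hS : (vertexGraph (φ.vertices k D)).IsIndepSet (S : Set (Fin (φ.vertices k D).length))) :
    S.card ≤ k + D := by
  rw [← Finset.card_range (k + D)]
  refine Finset.card_le_card_of_injOn (fun v => (φ.vertices k D)[v].1) ?_ ?_
  · intro v _
    rw [Finset.coe_range, Set.mem_Iio]
    obtain ⟨i, hi, T', hT', h⟩ | ⟨j, hj, C, hC, h⟩ :=
        mem_vertices.1 (List.getElem_mem (l := φ.vertices k D) v.2)
    · have h' : (φ.vertices k D)[v] = _ := h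
      simp only [h']
      omega
    · have h' : (φ.vertices k D)[v] = _ := h
      simp only [h']
      omega
  · intro u hu v hv h
    by_contra hne
    exact hS hu hv hne (vertexGraph_adj_of_class_eq h hne)

theorem opt_le (φ : ThreeCNF) (k D : ℕ) : mmis.opt (φ.reduction k D) ≤ k + D := by
  obtain ⟨S, hS⟩ := mmis_exists_feasible (φ.reduction k D)
  exact (opt_le_card hS).trans (card_le_of_isIndepSet hS.prop)

/-- Some copy of the clauses is missed by `S`. By maximality its vertices are dominated from other
classes, that is, by tables in `S` that satisfy them, and these tables merge into one assignment. -/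
theorem satisfiable_of_card_lt {S : Finset (Fin (φ.vertices k D).length)}
    (hS : Maximal (vertexGraph (φ.vertices k D)).IsIndepSet
      (S : Set (Fin (φ.vertices k D).length))) (hcard : S.card < D) : φ.Satisfiable := by
  have hex : ∃ j < D, ∀ v ∈ S, (φ.vertices k D)[v].1 ≠ k + j := by
    by_contra! hcon
    have : (Finset.range D).image (k + ·) ⊆ S.image fun v => (φ.vertices k D)[v].1 := by
      intro c hc
      obtain ⟨j, hj, rfl⟩ := Finset.mem_image.1 hc
      obtain ⟨v, hv, h⟩ := hcon j (Finset.mem_range.1 hj)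
      exact Finset.mem_image.2 ⟨v, hv, h⟩
    have h1 := (Finset.card_le_card this).trans Finset.card_image_le
    rw [Finset.card_image_of_injective _ (add_right_injective k), Finset.card_range] at h1
    omega
  obtain ⟨j, hj, hjS⟩ := hex
  have htab {u : Fin (φ.vertices k D).length} {l : ℕ × Bool} (hl : l ∈ (φ.vertices k D)[u].2.1) :
      l.1 % k = (φ.vertices k D)[u].1 ∧
        ∀ b, (l.1, b) ∈ (φ.vertices k D)[u].2.1 → b = l.2 := by
    obtain ⟨i, hi, T', hT', h⟩ | ⟨j, hj, C, hC, h⟩ :=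
        mem_vertices.1 (List.getElem_mem (l := φ.vertices k D) u.2)
    · have h' : (φ.vertices k D)[u] = _ := h
      rw [h'] at hl ⊢
      exact ⟨((mem_tables hT').1 l hl).1, fun b hb => (mem_tables hT').2.1 _ _ _ hb hl⟩
    · have h' : (φ.vertices k D)[u] = _ := h
      rw [h'] at hl
      simp at hl
  classical
  -- Variables on which no table in `S` decides get the value `false`.
  let τ : Fin φ.q → Bool := fun x => decide (∃ u ∈ S, ((x : ℕ), true) ∈ (φ.vertices k D)[u].2.1)
  have hτ {u : Fin (φ.vertices k D).length} (hu : u ∈ S) {l : Literal φ.q}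
      (hl : ((l.1 : ℕ), l.2) ∈ (φ.vertices k D)[u].2.1) : τ l.1 = l.2 := by
    rcases hb : l.2 with _ | _
    · refine decide_eq_false ?_
      rintro ⟨u', hu', hl'⟩
      -- Both tables mention the same variable, so they belong to the same group, which is a clique.
      have huu : u = u' := by
        by_contra hne
        exact hS.prop hu hu' hne
          (vertexGraph_adj_of_class_eq ((htab hl).1.symm.trans (htab hl').1) hne)
      subst huu
      have := (htab hl).2 _ hl'
      simp [hb] at this
    · exact decide_eq_true ⟨u, hu, hb ▸ hl⟩
  refine ⟨τ, fun C hC => ?_⟩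
  obtain ⟨v, hv⟩ := exists_index (φ := φ) (k := k) (D := D) (mem_vertices.2 (.inr ⟨j, hj, _,
    List.mem_map_of_mem hC, rfl⟩))
  have hvS : v ∉ S := fun h => hjS v h (by rw [hv])
  -- Otherwise `v` could be added to the maximal set `S`.
  have hadj : ∃ u ∈ S, (vertexGraph (φ.vertices k D)).Adj v u := by
    by_contra! hcon
    refine hvS (hS.le_of_ge (y := insert v (S : Set _)) ?_ (Set.subset_insert _ _)
      (Set.mem_insert _ _))
    intro a ha b hb hab
    rcases ha with rfl | ha <;> rcases hb with rfl | hb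
    · exact absurd rfl hab
    · exact hcon b hb
    · exact fun h => hcon a ha h.symm
    · exact hS.prop ha hb hab
  obtain ⟨u, hu, huv⟩ := hadj
  rw [vertexGraph_adj_iff_of_class_ne (by rw [hv]; exact (hjS u hu).symm), hv] at huv
  -- The first case is void: a clause vertex carries no literals and satisfies nothing.
  rcases huv with h | h
  · simp only [Vertex.sat] at h
    split at h <;> simp at h
  · simp only [Vertex.sat, List.any_eq_true, Bool.or_eq_true, decide_eq_true_eq] at h
    obtain ⟨l, hl, rfl | rfl | rfl⟩ := h
    · exact .inl (hτ hu (l := C.1) hl)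
    · exact .inr (.inl (hτ hu (l := C.2.1) hl))
    · exact .inr (.inr (hτ hu (l := C.2.2) hl))

end ThreeCNF


/-! ### The reduction in polynomial time -/

/-- Encoding of a literal. -/
def encLit (l : ℕ × Bool) : Tree := .cons (.ofNat l.1) (.ofBool l.2)

/-- Encoding of a clause. -/
def encClause (C : (ℕ × Bool) × (ℕ × Bool) × (ℕ × Bool)) : Tree :=
  .cons (encLit C.1) (.cons (encLit C.2.1) (encLit C.2.2))

/-- Encoding of a partial assignment. -/
def encTable (T : List (ℕ × Bool)) : Tree := .ofList (T.map encLit)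

/-- Encoding of an optional clause. -/
def encOption : Option ((ℕ × Bool) × (ℕ × Bool) × (ℕ × Bool)) → Tree
  | none => .nil
  | some C => encClause C

/-- Encoding of a vertex of the reduction. -/
def encVertex (v : Vertex) : Tree := .cons (.ofNat v.1) (.cons (encTable v.2.1) (encOption v.2.2))

/-- Encoding of a numbered vertex. -/
def encNumbered (v : Vertex × ℕ) : Tree := .cons (.ofNat v.2) (encVertex v.1)

theorem ThreeCNF.enc_eq (φ : ThreeCNF) :
    φ.enc = .cons (.ofNat φ.q) (.ofList (φ.natClauses.map encClause)) := by
  simp [ThreeCNF.enc, ThreeCNF.natClauses, Function.comp_def, encClause, encLit,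
    ThreeCNF.encLiteral]

theorem size_encTable_le {T : List (ℕ × Bool)} {q : ℕ} (h : ∀ l ∈ T, l.1 < q)
    (h' : T.length ≤ q) : (encTable T).size ≤ q * (2 * q + 6) + 1 := by
  refine (Tree.size_ofList_le (B := 2 * q + 5) ?_).trans ?_
  · intro a ha
    obtain ⟨l, hl, rfl⟩ := List.mem_map.1 ha
    have h1 := h l hl
    have h2 := Tree.size_ofBool_le l.2
    simp only [encLit, Tree.size, Tree.size_ofNat]
    omega
  · rw [List.length_map]
    gcongr

namespace PolyTime

variable {ι : Type*} {μ : ι → ℕ} {X : ι → Tree}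

theorem lit_eq {a b : ι → ℕ × Bool} (hX : PolyBdd μ fun i => (X i).size)
    (ha : PolyTime μ X fun i => encLit (a i)) (hb : PolyTime μ X fun i => encLit (b i)) :
    PolyTime μ X fun i => .ofBool (decide (a i = b i)) := by
  refine cast ?_ ((nat_eq hX ha.head hb.head).and (bool_beq ha.tail hb.tail))
  congr 1; funext i
  simp [Prod.ext_iff, Bool.beq_eq_decide_eq]

theorem sat {u v : ι → Vertex} (hX : PolyBdd μ fun i => (X i).size)
    (hu : PolyTime μ X fun i => encVertex (u i)) (hv : PolyTime μ X fun i => encVertex (v i)) :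
    PolyTime μ X fun i => .ofBool (Vertex.sat (u i) (v i)) := by
  -- A dummy clause where `v i` has none; the outcome computed from it is discarded by the final
  -- case distinction.
  let C : ι → (ℕ × Bool) × (ℕ × Bool) × (ℕ × Bool) := fun i =>
    (v i).2.2.getD ((0, false), (0, false), (0, false))
  have ho : PolyTime μ X fun i => encOption (v i).2.2 := hv.tail.tail
  have hC : PolyTime μ X fun i => encClause (C i) := by
    refine cast ?_ (ho.cond ho (.const (encClause ((0, false), (0, false), (0, false)))))
    congr 1; funext i
    cases h : (v i).2.2 <;> simp [C, h, encOption, encClause]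
  have ht : PolyTime μ X fun i => .ofList ((u i).2.1.map encLit) := hu.tail.head
  have hany : PolyTime μ X fun i => .ofBool ((u i).2.1.any fun l => decide (l = (C i).1) ||
      (decide (l = (C i).2.1) || decide (l = (C i).2.2))) := by
    have hs := PolyBdd.size_mem ht.size (fun j : {j : ι × (ℕ × Bool) // j.2 ∈ (u j.1).2.1} => j.1.1)
      (fun j => j.1.2) (fun j => j.2)
    have hX' := (hX.reindex
      (fun j : {j : ι × (ℕ × Bool) // j.2 ∈ (u j.1).2.1} => j.1.1)).size_cons hs
    have hl := arg hX hs
    have hC' := lift hX hs hC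
    exact any hX ht ((lit_eq hX' hl hC'.head).or
      ((lit_eq hX' hl hC'.tail.head).or (lit_eq hX' hl hC'.tail.tail)))
  refine cast ?_ (ho.cond hany .nil)
  congr 1; funext i
  simp only [Vertex.sat]
  cases h : (v i).2.2 <;> simp [C, h, encOption, encClause, Tree.ofBool]

theorem adj {u v : ι → Vertex × ℕ} (hX : PolyBdd μ fun i => (X i).size)
    (hu : PolyTime μ X fun i => encNumbered (u i))
    (hv : PolyTime μ X fun i => encNumbered (v i)) :
    PolyTime μ X fun i => .ofBool (Vertex.adj (u i) (v i)) := by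
  refine cast ?_ ((nat_eq hX hu.tail.head hv.tail.head).ite (nat_eq hX hu.head hv.head).not
    ((sat hX hu.tail hv.tail).or (sat hX hv.tail hu.tail)))
  congr 1; funext i
  simp only [Vertex.adj]
  by_cases h : (u i).1.1 = (v i).1.1 <;> simp [h]

/-- A formula may list a clause twice, so equal entries of `W` can be different vertices; the
positions supplied by `zipIdx` distinguish them. -/
theorem encInst_eq (W : List Vertex) : mmis.encInst ⟨W.length, vertexGraph W⟩ =
    .ofList (W.zipIdx.map fun u => .ofList (W.zipIdx.map fun v =>
      .ofBool (Vertex.adj u v))) := by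
  classical
  change Tree.ofList (List.ofFn fun u : Fin W.length => Tree.ofList (List.ofFn fun v =>
    .ofBool (decide ((vertexGraph W).Adj u v)))) = _
  congr 1
  refine List.ext_getElem (by simp) fun i h1 h2 => ?_
  simp only [List.getElem_ofFn, List.getElem_map, List.getElem_zipIdx, Nat.zero_add]
  congr 1
  refine List.ext_getElem (by simp) fun j h3 h4 => ?_
  simp only [List.getElem_ofFn, List.getElem_map, List.getElem_zipIdx, Nat.zero_add]
  congr 1
  simp only [vertexGraph, Fin.getElem_fin]
  exact Bool.decide_eq_true

theorem encInst {W : ι → List Vertex} (hX : PolyBdd μ fun i => (X i).size)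
    (hW : PolyTime μ X fun i => .ofList ((W i).map encVertex)) :
    PolyTime μ X fun i => mmis.encInst ⟨(W i).length, vertexGraph (W i)⟩ := by
  simp only [encInst_eq]
  have hN : PolyTime μ X fun i => .ofList ((W i).zipIdx.map encNumbered) := zipIdx hX hW
  have hs := PolyBdd.size_mem hN.size
    (fun j : {j : ι × (Vertex × ℕ) // j.2 ∈ (W j.1).zipIdx} => j.1.1) (fun j => j.1.2)
    (fun j => j.2)
  have hX' := (hX.reindex
    (fun j : {j : ι × (Vertex × ℕ) // j.2 ∈ (W j.1).zipIdx} => j.1.1)).size_cons hs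
  refine map hX hN ?_
  have hN' := lift hX hs hN
  have hu := arg hX hs
  have hs' := PolyBdd.size_mem hN'.size
    (fun j : {j : {j : ι × (Vertex × ℕ) // j.2 ∈ (W j.1).zipIdx} × (Vertex × ℕ) //
      j.2 ∈ (W j.1.1.1).zipIdx} => j.1.1) (fun j => j.1.2) (fun j => j.2)
  have hX'' := (hX'.reindex
    (fun j : {j : {j : ι × (Vertex × ℕ) // j.2 ∈ (W j.1).zipIdx} × (Vertex × ℕ) //
      j.2 ∈ (W j.1.1.1).zipIdx} => j.1.1)).size_cons hs'
  exact map (G := fun j v => .ofBool (Vertex.adj j.1.2 v)) hX' hN'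
    (adj hX'' (lift hX' hs' hu) (arg hX' hs'))

/-- The only exponential object of the reduction: `hpow` lets the measure `μ` absorb the number of
tables. -/
theorem tables {k r q : ι → ℕ} (hX : PolyBdd μ fun i => (X i).size) (hr : ∀ i, r i < k i)
    (hpow : PolyBdd μ fun i => 2 ^ (q i / k i + 1))
    (hk : PolyTime μ X fun i => .ofNat (k i)) (hr' : PolyTime μ X fun i => .ofNat (r i))
    (hq : PolyTime μ X fun i => .ofNat (q i)) :
    PolyTime μ X fun i => .ofList ((FPTHardness.tables (k i) (r i) (q i)).map encTable) := by
  have hqb : PolyBdd μ q := hq.size.mono fun i => by rw [Tree.size_ofNat]; omega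
  have hs : PolyBdd (ι := {j : ι × ℕ // j.2 < q j.1}) (fun j => μ j.1.1) fun j =>
      (Tree.cons (.ofNat j.1.2)
        (.ofList ((FPTHardness.tables (k j.1.1) (r j.1.1) j.1.2).map encTable))).size := by
    refine ((hq.size.add ((hpow.mul (((hqb.mul (((PolyBdd.const 2).mul hqb).add (.const 6))).add
      (.const 1)).add (.const 1))).add (.const 1))).add (.const 1)).reindex
      (fun j : {j : ι × ℕ // j.2 < q j.1} => j.1.1) |>.mono fun j => ?_
    have hj := j.2
    simp only [Tree.size, Tree.size_ofNat]
    refine Nat.add_le_add (Nat.add_le_add (by omega) ((Tree.size_ofList_le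
      (B := q j.1.1 * (2 * q j.1.1 + 6) + 1) ?_).trans ?_)) le_rfl
    · intro a ha
      obtain ⟨T, hT, rfl⟩ := List.mem_map.1 ha
      obtain ⟨h1, -, h3⟩ := mem_tables hT
      exact size_encTable_le (fun l hl => (h1 l hl).2.trans hj) (h3.trans hj.le)
    · rw [List.length_map]
      gcongr
      refine (length_tables_le (hr _) _).trans ?_
      gcongr
      norm_num
  have := fold_nat (st := fun i j => .cons (.ofNat j)
      (.ofList ((FPTHardness.tables (k i) (r i) j).map encTable))) hX hq
    (.const (.cons (.ofNat 0) (.ofList [encTable []]))) hs (by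
      have hX' := (hX.reindex (fun j : {j : ι × ℕ // j.2 < q j.1} => j.1.1)).size_cons hs
      have ha := arg hX hs
      have hm (b : Bool) := map (G := fun j T => .cons (encLit (j.1.2, b)) (encTable T)) hX'
        ha.tail (by
          have hs' := PolyBdd.size_mem ha.tail.size (fun j : {j : {j : ι × ℕ // j.2 < q j.1} ×
            List (ℕ × Bool) // j.2 ∈ FPTHardness.tables (k j.1.1.1) (r j.1.1.1) j.1.1.2} => j.1.1)
            (fun j => j.1.2) (fun j => j.2)
          exact ((lift hX' hs' ha.head).cons (.const (.ofBool b))).cons (arg hX' hs'))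
      refine cast ?_ (ha.head.succ.cons ((nat_eq hX' (mod hX' (fun j => (hr j.1.1).pos)
        ha.head (lift hX hs hk)) (lift hX hs hr')).ite (append hX' (hm true) (hm false)) ha.tail))
      congr 1; funext j
      rw [FPTHardness.tables]
      by_cases h : j.1.2 % k j.1.1 = r j.1.1
      · simp [h, Function.comp_def, encTable, Tree.ofList]
      · simp [h])
  exact this.tail

theorem vertices {φ : ι → ThreeCNF} {k D : ι → ℕ} (hX : PolyBdd μ fun i => (X i).size)
    (hpow : PolyBdd μ fun i => 2 ^ ((φ i).q / k i + 1)) (hφ : PolyTime μ X fun i => (φ i).enc)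
    (hk : PolyTime μ X fun i => .ofNat (k i)) (hD : PolyTime μ X fun i => .ofNat (D i)) :
    PolyTime μ X fun i => .ofList (((φ i).vertices (k i) (D i)).map encVertex) := by
  simp only [ThreeCNF.enc_eq] at hφ
  have h1 : PolyTime μ X fun i => .ofList ((List.range (k i)).flatMap fun j =>
      (FPTHardness.tables (k i) j (φ i).q).map fun T =>
        .cons (.ofNat j) (.cons (encTable T) .nil)) := by
    have hr := range hX hk
    have hs := PolyBdd.size_mem hr.size
      (fun j : {j : ι × ℕ // j.2 ∈ List.range (k j.1)} => j.1.1) (fun j => j.1.2) (fun j => j.2)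
    have hX' := (hX.reindex
      (fun j : {j : ι × ℕ // j.2 ∈ List.range (k j.1)} => j.1.1)).size_cons hs
    have ha := arg hX hs
    have ht := tables hX' (fun j => List.mem_range.1 j.2) (hpow.reindex _) (lift hX hs hk) ha
      (lift hX hs hφ.head)
    refine flatMap hX hr ?_
    have hs' := PolyBdd.size_mem ht.size (fun j : {j : {j : ι × ℕ // j.2 ∈ List.range (k j.1)} ×
      List (ℕ × Bool) // j.2 ∈ FPTHardness.tables (k j.1.1.1) j.1.1.2 (φ j.1.1.1).q} => j.1.1)
      (fun j => j.1.2) (fun j => j.2)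
    exact map (G := fun j T => .cons (.ofNat j.1.2) (.cons (encTable T) .nil)) hX' ht
      ((lift hX' hs' ha).cons ((arg hX' hs').cons .nil))
  have h2 : PolyTime μ X fun i => .ofList ((List.range (D i)).flatMap fun j =>
      (φ i).natClauses.map fun C => .cons (.ofNat (k i + j)) (.cons .nil (encClause C))) := by
    have hr := range hX hD
    have hs := PolyBdd.size_mem hr.size
      (fun j : {j : ι × ℕ // j.2 ∈ List.range (D j.1)} => j.1.1) (fun j => j.1.2) (fun j => j.2)
    have hX' := (hX.reindex
      (fun j : {j : ι × ℕ // j.2 ∈ List.range (D j.1)} => j.1.1)).size_cons hs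
    have ha := add hX' (lift hX hs hk) (arg hX hs)
    have ht := lift hX hs hφ.tail
    refine flatMap hX hr ?_
    have hs' := PolyBdd.size_mem ht.size (fun j : {j : {j : ι × ℕ // j.2 ∈ List.range (D j.1)} ×
      ((ℕ × Bool) × (ℕ × Bool) × (ℕ × Bool)) // j.2 ∈ (φ j.1.1.1).natClauses} => j.1.1)
      (fun j => j.1.2) (fun j => j.2)
    exact map (G := fun j C => .cons (.ofNat (k j.1.1 + j.1.2)) (.cons .nil (encClause C))) hX' ht
      ((lift hX' hs' ha).cons (PolyTime.nil.cons (arg hX' hs')))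
  refine cast ?_ (append hX h1 h2)
  congr 1; funext i
  simp [ThreeCNF.vertices, List.map_flatMap, Function.comp_def, encVertex, encOption, encTable,
    Tree.ofList]

end PolyTime


/-! ### Hardness -/

theorem ThreeCNF.length_natClauses (φ : ThreeCNF) : φ.natClauses.length = φ.m := by
  simp [ThreeCNF.natClauses, ThreeCNF.m]

theorem ThreeCNF.size_enc_le (φ : ThreeCNF) :
    φ.enc.size ≤ (2 * φ.q + 1) + (φ.m * (6 * φ.q + 21) + 1) + 1 := by
  rw [ThreeCNF.enc_eq, ← φ.length_natClauses]
  simp only [Tree.size, Tree.size_ofNat]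
  refine Nat.add_le_add (Nat.add_le_add le_rfl ((Tree.size_ofList_le (B := 6 * φ.q + 20) ?_).trans
    (by simp))) le_rfl
  intro a ha
  obtain ⟨C, hC, rfl⟩ := List.mem_map.1 ha
  obtain ⟨C, hC, rfl⟩ := List.mem_map.1 hC
  have h1 := Tree.size_ofBool_le C.1.2
  have h2 := Tree.size_ofBool_le C.2.1.2
  have h3 := Tree.size_ofBool_le C.2.2.2
  have h4 := C.1.1.2
  have h5 := C.2.1.1.2
  have h6 := C.2.2.1.2
  simp only [encClause, encLit, Tree.size, Tree.size_ofNat]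
  omega

/-- The time scale of the reduction with `κ q` groups of variables. -/
def timeScale (κ : ℕ → ℕ) (φ : ThreeCNF) : ℕ := φ.q + φ.m + 2 ^ (φ.q / κ φ.q + 1)

theorem isLittleO_div {κ : ℕ → ℕ} (hκ : Tendsto κ atTop atTop) (c : ℕ) :
    (fun q : ℕ => ((c * (q / κ q + 1) : ℕ) : ℝ)) =o[atTop] fun q : ℕ => (q : ℝ) := by
  rw [isLittleO_iff]
  intro ε hε
  -- Once `κ q` and `q` are both at least `N`, each of the two summands `c * (q / κ q)` and `c` is
  -- at most `ε / 2 * q`.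
  obtain ⟨N, hN⟩ := exists_nat_gt (2 * c / ε)
  have hN' : 2 * (c : ℝ) < N * ε := by rwa [div_lt_iff₀ hε] at hN
  have hNpos : (0 : ℝ) < N := lt_of_le_of_lt (by positivity) hN
  filter_upwards [hκ.eventually_ge_atTop N, eventually_ge_atTop N] with q h1 h2
  have h1' : (N : ℝ) ≤ κ q := by exact_mod_cast h1
  have h2' : (N : ℝ) ≤ q := by exact_mod_cast h2
  have h3 : ((q / κ q : ℕ) : ℝ) ≤ q / N :=
    Nat.cast_div_le.trans (div_le_div_of_nonneg_left (by positivity) hNpos h1')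
  rw [Real.norm_of_nonneg (by positivity), Real.norm_of_nonneg (by positivity)]
  push_cast
  have h4 : (c : ℝ) * (q / N) ≤ ε / 2 * q := by
    rw [← mul_div_assoc, div_le_iff₀ hNpos]
    nlinarith [Nat.cast_nonneg (α := ℝ) q]
  have h5 : (c : ℝ) ≤ ε / 2 * q := by nlinarith
  have h6 : (c : ℝ) * ((q / κ q : ℕ) : ℝ) ≤ c * (q / N) := by gcongr
  linarith

-- A polynomial in the time scale is `2 ^ (c * (q / κ q + 1))` times a polynomial in `q + m`, and
-- the exponent is `o(q)` because `κ` is unbounded in the limit.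
open Classical in
theorem exists_decidesThreeSatSubexp {κ : ℕ → ℕ} (hκ : Tendsto κ atTop atTop)
    (h : PolyTime (timeScale κ) ThreeCNF.enc fun φ => .ofBool (decide φ.Satisfiable)) :
    ∃ p, DecidesThreeSatSubexp p := by
  obtain ⟨p, T, ⟨c, hT⟩, hr, -⟩ := h
  refine ⟨p, fun q => ((c * (q / κ q + 1) : ℕ) : ℝ), 2 ^ c, c, isLittleO_div hκ c, fun φ => ?_⟩
  obtain ⟨n, hn, hrun⟩ := hr φ
  refine ⟨n, hrun.computes, ?_⟩
  have key : n ≤ 2 ^ c * 2 ^ (c * (φ.q / κ φ.q + 1)) * (φ.q + φ.m + 1) ^ c := by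
    refine (hn.trans (hT φ)).trans ?_
    rw [mul_comm c, pow_mul, ← mul_pow, ← mul_pow]
    refine Nat.pow_le_pow_left ?_ c
    -- For `P ≥ 2` one has `s + P + 2 ≤ 2 * P * (s + 1)`, which separates the exponential factor
    -- from `s = q + m`.
    have hP : 2 ≤ 2 ^ (φ.q / κ φ.q + 1) := by
      rw [pow_succ]
      have := Nat.one_le_two_pow (n := φ.q / κ φ.q)
      omega
    rw [timeScale]
    nlinarith [Nat.mul_le_mul_left (φ.q + φ.m) hP]
  rw [Real.rpow_natCast]
  exact_mod_cast key

theorem count_ofFn_mem {n : ℕ} (S : Finset (Fin n)) [DecidablePred (· ∈ S)] :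
    (List.ofFn fun v => decide (v ∈ S)).count true = S.card := by
  rw [List.ofFn_eq_map, List.count, List.countP_map, List.countP_eq_length_filter,
    ← List.toFinset_card_of_nodup ((List.nodup_finRange n).filter _)]
  congr 1
  ext v
  simp

/-- Truncated subtraction serves as comparison: the difference is nonzero exactly when the count is
below `D i`. -/
theorem PolyTime.sub_count {ι : Type*} {μ : ι → ℕ} {X : ι → Tree} {D : ι → ℕ} {l : ι → List Bool}
    (hX : PolyBdd μ fun i => (X i).size) (hD : PolyTime μ X fun i => .ofNat (D i))
    (hl : PolyTime μ X fun i => .ofList ((l i).map .ofBool)) :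
    PolyTime μ X fun i => .ofNat (D i - (l i).count true) := by
  have hs : PolyBdd (ι := {j : ι × List Bool × Bool // j.2.1 ++ [j.2.2] <+: l j.1})
      (fun j => μ j.1.1) fun j => (Tree.ofNat (D j.1.1 - j.1.2.1.count true)).size :=
    (hD.size.reindex _).mono fun j => by simp only [Tree.size_ofNat]; omega
  have ha := PolyBdd.size_mem hl.size
    (fun j : {j : ι × List Bool × Bool // j.2.1 ++ [j.2.2] <+: l j.1} => j.1.1)
    (fun j => j.1.2.2) (fun j => mem_of_prefix j.2)
  refine fold_list (st := fun i m => .ofNat (D i - m.count true)) hX hl (by simpa using hD) ?_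
  have h := arg hX (ha.size_cons hs)
  refine cast ?_ (h.head.ite h.tail.tail h.tail)
  congr 1; funext j
  rw [List.count_append, ← Nat.sub_sub]
  cases j.1.2.2
  · simp
  · cases D j.1.1 - j.1.2.1.count true <;> simp [Tree.ofNat]

/-- The number of copies of the clauses. -/
def copies (r : ℕ → ℕ) (k : ℕ) : ℕ := k * r k + 1

/-- The reduction can be computed with a slowly growing number `κ q` of groups of variables. -/
theorem exists_polyTime_reduction {r t : ℕ → ℕ} (hrc : Computable r) (htc : Computable t) :
    ∃ κ : ℕ → ℕ, (∀ q, 1 ≤ κ q) ∧ Tendsto κ atTop atTop ∧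
      PolyBdd (timeScale κ) (fun φ => φ.enc.size) ∧
      PolyBdd (timeScale κ) (fun φ => t (κ φ.q + copies r (κ φ.q))) ∧
      PolyTime (timeScale κ) ThreeCNF.enc (fun φ => .ofNat (κ φ.q)) ∧
      PolyTime (timeScale κ) ThreeCNF.enc (fun φ => .ofNat (copies r (κ φ.q))) ∧
      PolyTime (timeScale κ) ThreeCNF.enc
        (fun φ => mmis.encInst (φ.reduction (κ φ.q) (copies r (κ φ.q)))) := by
  have hD : Computable (copies r) :=
    Computable.succ.comp (Primrec.nat_mul.to_comp.comp Computable.id hrc)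
  -- The argument `k + copies r k` is the bound on `OPT` valid for every formula.
  have hT : Computable fun k => t (k + copies r k) :=
    htc.comp (Primrec.nat_add.to_comp.comp Computable.id hD)
  obtain ⟨κ, c, h1, h2, h3, h4, h5, h6⟩ := exists_slow hD hT
  have hq : PolyBdd (timeScale κ) fun φ => φ.q := PolyBdd.self.mono fun φ =>
    (Nat.le_add_right _ _).trans (Nat.le_add_right _ _)
  have hm : PolyBdd (timeScale κ) fun φ => φ.m := PolyBdd.self.mono fun φ =>
    (Nat.le_add_left _ _).trans (Nat.le_add_right _ _)
  have hpow : PolyBdd (timeScale κ) fun φ => 2 ^ (φ.q / κ φ.q + 1) :=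
    PolyBdd.self.mono fun φ => Nat.le_add_left _ _
  have hX : PolyBdd (timeScale κ) fun φ => φ.enc.size :=
    (((((PolyBdd.const 2).mul hq).add (.const 1)).add
      ((hm.mul (((PolyBdd.const 6).mul hq).add (.const 21))).add (.const 1))).add
        (.const 1)).mono ThreeCNF.size_enc_le
  have henc : PolyTime (timeScale κ) ThreeCNF.enc ThreeCNF.enc := .id hX
  have hqt : PolyTime (timeScale κ) ThreeCNF.enc fun φ => .ofNat φ.q := henc.head
  have hslow := PolyTime.trans_reindex (fun φ : ThreeCNF => φ.q) hqt h6 hq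
  refine ⟨κ, h1, h3, hX, ((PolyBdd.const c).mul (hq.add (.const 1))).mono fun φ => h5 _,
    hslow.head, hslow.tail, ?_⟩
  exact PolyTime.encInst hX (PolyTime.vertices hX hpow henc hslow.head hslow.tail)

/-- The output of a program that is fast on the instances of a family. -/
theorem PolyTime.of_computes {ι : Type*} {μ : ι → ℕ} {X Y Z : ι → Tree} {p : Prog}
    (h : PolyTime μ X Y) {T : ι → ℕ} (hT : PolyBdd μ T) (hZ : PolyBdd μ fun i => (Z i).size)
    (hp : ∀ i, ∃ n ≤ T i, Computes p (Y i) n (Z i)) : PolyTime μ X Z :=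
  h.trans ⟨p.tidy, fun i => T i + (p.bound + 1), hT.add (.const _), fun i => by
    obtain ⟨n, hn, hc⟩ := hp i
    exact ⟨_, Nat.add_le_add_right hn _, hc.tidy⟩, hZ⟩

/-- The running time alone does not bound the size of an output, as `cons` can double a tree in one
step. -/
theorem size_encSol_le (I : mmis.Inst) (S : mmis.Sol I) :
    (mmis.encSol I S).size ≤ mmis.instSize I * 4 + 1 := by
  classical
  have h1 : (mmis.encSol I S).size ≤ I.1 * (3 + 1) + 1 := by
    refine (Tree.size_ofList_le (B := 3) ?_).trans (by rw [List.length_ofFn])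
    intro a ha
    obtain ⟨v, rfl⟩ := (List.mem_ofFn' _ _).1 ha
    exact Tree.size_ofBool_le _
  have h2 : I.1 ≤ mmis.instSize I :=
    (List.length_ofFn.symm.le).trans (Tree.length_le_size_ofList _)
  omega

/-- The formula is satisfiable exactly when the returned set has fewer vertices than there are
copies of the clauses, so counting its vertices decides 3-SAT. -/
theorem mmis_hardInOpt (hETH : ETH) {r t : ℕ → ℕ} (hr : Monotone r) (ht : Monotone t)
    (hrc : Computable r) (htc : Computable t) : mmis.FPTHardInOpt r t := by
  classical
  rintro ⟨p, a, c, hp⟩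
  obtain ⟨κ, h1, hκ, hX, htb, hk, hD, hI⟩ := exists_polyTime_reduction hrc htc
  refine hETH (exists_decidesThreeSatSubexp hκ ?_)
  let I : ThreeCNF → mmis.Inst := fun φ => φ.reduction (κ φ.q) (copies r (κ φ.q))
  choose n S hc hn hS hv using fun φ => hp (I φ)
  let S' : ∀ φ, Finset (Fin (I φ).1) := S
  have hsol : PolyTime (timeScale κ) ThreeCNF.enc fun φ => mmis.encSol (I φ) (S φ) := by
    refine hI.of_computes
      (((PolyBdd.const a).mul htb).mul (hI.size.pow c))
      (((hI.size.mul (.const 4)).add (.const 1)).mono fun φ => size_encSol_le _ _)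
      fun φ => ⟨n φ, (hn φ).trans ?_, hc φ⟩
    dsimp only [MinProblem.instSize, I]
    gcongr
    exact ht (ThreeCNF.opt_le _ _ _)
  have hl : PolyTime (timeScale κ) ThreeCNF.enc fun φ => .ofList
      ((List.ofFn fun v : Fin (I φ).1 => decide (v ∈ S' φ)).map .ofBool) := by
    refine cast ?_ hsol
    congr 1; funext φ
    rw [List.map_ofFn]
    change Tree.ofList _ = Tree.ofList _
    congr 2
  have hcount := (PolyTime.sub_count hX hD hl).cond (.const (.ofBool true)) (.const (.ofBool false))
  refine cast ?_ hcount
  congr 1; funext φ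
  rw [count_ofFn_mem]
  have hiff : φ.Satisfiable ↔ (S' φ).card < copies r (κ φ.q) := by
    refine ⟨fun h => ?_, ThreeCNF.satisfiable_of_card_lt (hS φ)⟩
    have ho : mmis.opt (I φ) ≤ κ φ.q := ThreeCNF.opt_le_of_satisfiable (h1 _) h
    -- As `OPT ≤ κ q` and `r` is monotone, `r(OPT) * OPT` is at most `κ q * r (κ q)`, one less than
    -- the number of copies.
    refine Nat.lt_succ_of_le ((hv φ).trans ?_)
    rw [mul_comm]
    exact Nat.mul_le_mul ho (hr ho)
  by_cases h : φ.Satisfiable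
  · obtain ⟨d, hd⟩ := Nat.exists_eq_succ_of_ne_zero (Nat.sub_pos_of_lt (hiff.1 h)).ne'
    rw [hd]
    simp [h, Tree.ofNat]
  · rw [Nat.sub_eq_zero_of_le (not_lt.1 (mt hiff.2 h))]
    simp [h, Tree.ofNat]

/-- With the parameter `κ q`, the kind of answer already decides: a solution has fewer vertices than
there are copies and proves satisfiability, whereas `κ q < OPT` refutes it. -/
theorem mmis_hardInParam (hETH : ETH) {r t : ℕ → ℕ} (ht : Monotone t)
    (hrc : Computable r) (htc : Computable t) : mmis.FPTHardInParam r t := by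
  classical
  rintro ⟨p, a, c, hp⟩
  obtain ⟨κ, h1, hκ, hX, htb, hk, hD, hI⟩ := exists_polyTime_reduction hrc htc
  refine hETH (exists_decidesThreeSatSubexp hκ ?_)
  let I : ThreeCNF → mmis.Inst := fun φ => φ.reduction (κ φ.q) (copies r (κ φ.q))
  choose n o hc hn ho using fun φ => hp (I φ) (κ φ.q)
  have hout : PolyTime (timeScale κ) ThreeCNF.enc o := by
    refine (hI.cons hk).of_computes
      (((PolyBdd.const a).mul htb).mul (hI.size.pow c))
      (((hI.size.mul (.const 4)).add (.const 3)).mono fun φ => ?_)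
      fun φ => ⟨n φ, (hn φ).trans ?_, hc φ⟩
    · rcases ho φ with ⟨S, h, -⟩ | ⟨h, -⟩
      · have : (mmis.encSol (I φ) S).size ≤
            (mmis.encInst (φ.reduction (κ φ.q) (copies r (κ φ.q)))).size * 4 + 1 :=
          size_encSol_le (I φ) S
        rw [h]
        simp only [Tree.size]
        omega
      · rw [h]
        simp only [Tree.size]
        omega
    · dsimp only [MinProblem.instSize, I]
      gcongr
      exact ht (Nat.le_add_right _ _)
  refine cast ?_ (hout.cond (.const (.ofBool true)) (.const (.ofBool false)))
  congr 1; funext φ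
  rcases ho φ with ⟨S, h, hS, hv⟩ | ⟨h, hlt⟩
  · have : φ.Satisfiable := ThreeCNF.satisfiable_of_card_lt hS (Nat.lt_succ_of_le hv)
    rw [h]
    simp [this]
  · have : ¬ φ.Satisfiable := fun hsat =>
      absurd (ThreeCNF.opt_le_of_satisfiable (h1 _) hsat) (not_le.2 hlt)
    rw [h]
    simp [this]

end FPTHardness

theorem theorem4 (hETH : FPTHardness.ETH) (r t : ℕ → ℕ)
    (hr : Monotone r) (ht : Monotone t) (hrc : Computable r) (htc : Computable t) :
    FPTHardness.mmis.FPTHardInOpt r t ∧ FPTHardness.mmis.FPTHardInParam r t :=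
  ⟨FPTHardness.mmis_hardInOpt hETH hr ht hrc htc, FPTHardness.mmis_hardInParam hETH ht hrc htc⟩
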